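/- All Borel spaces are standard, all Hilbert spaces are separable (real or complex), and measures are $\sigma$-finite. Let $(G,\lambda)$ be a Borel groupoid with unit space $G^{(0)}$, range and source maps $r,s$, and Haar system $\lambda=\{\lambda^u: u\in G^{(0)}\}$, i.e. a Borel family of measures on the fibres $G^u=r^{-1}(u)$, invariant under left translation, for which some strictly positive Borel function on $G$ has integral $1$ on every fibre. For a left Borel $G$-space $X$ (with Borel surjective anchor map $r:X\to G^{(0)}$), let $X\rtimes G=\{(x,\gamma): r(x)=r(\gamma)\}$ be the semi-direct Borel groupoid with $r(x,\gamma)=x$, $s(x,\gamma)=\gamma^{-1}x$, $(x,\gamma)(\gamma^{-1}x,\gamma')=(x,\gamma\gamma')$ and Haar system $\{\delta_x\times\lambda^{r(x)}\}$. A measure $\mu$ on $X$ is quasi-invariant if $\mu\circ\lambda=\int\delta_x\times\lambda^{r(x)}\,d\mu(x)$ is equivalent to its image under inversion, and the $G$-space $(X,\mu)$ is ergodic if every invariant Borel subset of $X$ is $\mu$-null or $\mu$-conull. Let $(Y,\nu)$ and $(X,\mu)$ be ergodic left Borel $G$-spaces with quasi-invariant measures, let $p:Y\to X$ be a $G$-equivariant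 Borel map such that $\mu$ is equivalent to the image under $p$ of a finite measure equivalent to $\nu$, and assume that the pair is measure preserving: $\nu=\int\rho^x\,d\mu(x)$, where $\{\rho^x:x\in X\}$ is a Borel family of probability measures on the fibres $p^{-1}(x)$ which is invariant, i.e. $\gamma\rho^x=\rho^{\gamma x}$ whenever $s(\gamma)=r(x)$. Let $\phi:Y\rtimes G\to X\rtimes G$ be the homomorphism $\phi(y,\gamma)=(p(y),\gamma)$. Let $L$ be a representation of the measured groupoid $(X\rtimes G,[\mu])$ in a Hilbert bundle $\mathcal H$ over $X$: a Borel family of operators $L(\omega):\mathcal H(s(\omega))\to\mathcal H(r(\omega))$, $\omega\in X\rtimes G$, which on the reduction of $X\rtimes G$ to some $\mu$-conull Borel set is a homomorphism into Hilbert isomorphisms. Let $Z^1((X\rtimes G,[\mu]),L)$ be the space of Borel sections $b$ of $r^*\mathcal H$ with $b(\omega_1\omega_2)=b(\omega_1)+L(\omega_1)b(\omega_2)$ for almost all composable pairs (with respect to the class of $f\mapsto\int f(\omega_1^{-1},\omega_2)\,d\lambda^x(\omega_1)d\lambda^x(\omega_2)d\mu(x)$, where $\lambda^x$ denotes the Haar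 measure on $(X\rtimes G)^x$), modulo equality $\mu\circ\lambda$-almost everywhere; let $B^1$ be the subspace of the classes of those $b$ for which there is a Borel section $\xi$ of $\mathcal H$ with $b(\omega)=\xi(r(\omega))-L(\omega)\xi(s(\omega))$ for $\mu\circ\lambda$-almost every $\omega$; and let $H^1=Z^1/B^1$. Let $H^1((Y\rtimes G,[\nu]),L\circ\phi)$ be defined in the same way from the representation $L\circ\phi$ of $(Y\rtimes G,[\nu])$ in the pull-back bundle $p^*\mathcal H$. Then, for every such representation $L$, the map $$\phi^*:H^1((X\rtimes G,[\mu]),L)\to H^1((Y\rtimes G,[\nu]),L\circ\phi)$$ induced by $b\mapsto b\circ\phi$ is injective. -/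

import Mathlib

open MeasureTheory ProbabilityTheory
open scoped ENNReal NNReal

noncomputable section

namespace MeasGrpd

universe u v w

/-! ### Borel systems of measures -/

/-- The fibre `p⁻¹(x)` of a map `p`, with the Borel structure of a subspace. -/
abbrev Fib {Z : Type*} {X : Type*} (p : Z → X) (x : X) : Type _ := {z : Z // p z = x}

/-- A Borel system of measures for `p : Z → X`: a family of measures `ρ x` on the fibres `p⁻¹(x)`
such that `x ↦ ∫ f dρ x` is Borel for every non-negative Borel function `f` on `Z`. -/
structure BorelSystem {Z : Type*} {X : Type*} [MeasurableSpace Z] [MeasurableSpace X]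
    (p : Z → X) where
  meas : ∀ x, Measure (Fib p x)
  borel : ∀ f : Z → ℝ≥0∞, Measurable f → Measurable fun x => ∫⁻ z, f z.1 ∂(meas x)

/-- A Borel system is proper if some strictly positive Borel function has all integrals `1`. -/
def BorelSystem.IsProper {Z : Type*} {X : Type*} [MeasurableSpace Z] [MeasurableSpace X]
    {p : Z → X} (ρ : BorelSystem p) : Prop :=
  ∃ f : Z → ℝ≥0, Measurable f ∧ (∀ z, 0 < f z) ∧ ∀ x, ∫⁻ z, (f z.1 : ℝ≥0∞) ∂(ρ.meas x) = 1

/-- A Borel system, seen as a kernel from `X` to `Z`. -/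
def BorelSystem.toKernel {Z : Type*} {X : Type*} [MeasurableSpace Z] [MeasurableSpace X]
    {p : Z → X} (ρ : BorelSystem p) : Kernel X Z where
  toFun x := (ρ.meas x).map Subtype.val
  measurable' := by
    refine Measure.measurable_of_measurable_coe _ fun s hs => ?_
    have h := ρ.borel (s.indicator 1) (measurable_one.indicator hs)
    refine Eq.mp (congrArg Measurable (funext fun x => ?_)) h
    rw [Measure.map_apply measurable_subtype_coe hs,
      ← lintegral_indicator_one (measurable_subtype_coe hs)]
    rfl

/-- The measure `∫ ρ x dμ(x)` on `Z`, that is `f ↦ ∫ (∫ f dρ x) dμ(x)`. -/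
def BorelSystem.integrate {Z : Type*} {X : Type*} [MeasurableSpace Z] [MeasurableSpace X]
    {p : Z → X} (ρ : BorelSystem p) (μ : Measure X) : Measure Z :=
  μ.bind ρ.toKernel

theorem BorelSystem.lintegral_toKernel {Z : Type*} {X : Type*} [MeasurableSpace Z]
    [MeasurableSpace X] {p : Z → X} (ρ : BorelSystem p) (x : X) {f : Z → ℝ≥0∞}
    (hf : Measurable f) : ∫⁻ z, f z ∂(ρ.toKernel x) = ∫⁻ z, f z.1 ∂(ρ.meas x) := by
  change ∫⁻ z, f z ∂((ρ.meas x).map Subtype.val) = _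
  rw [lintegral_map hf measurable_subtype_coe]

theorem BorelSystem.isSFiniteKernel {Z : Type*} {X : Type*} [MeasurableSpace Z]
    [MeasurableSpace X] {p : Z → X} (ρ : BorelSystem p) (hρ : ρ.IsProper) :
    IsSFiniteKernel ρ.toKernel := by
  obtain ⟨f, hf, hpos, hint⟩ := hρ
  have hf' : Measurable fun z => (f z : ℝ≥0∞) := hf.coe_nnreal_ennreal
  let κ : Kernel X Z :=
    { toFun := fun x => (ρ.toKernel x).withDensity fun z => (f z : ℝ≥0∞)
      measurable' := by
        refine Measure.measurable_of_measurable_coe _ fun s hs => ?_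
        simp_rw [withDensity_apply _ hs]
        have h := ρ.borel (s.indicator fun z => (f z : ℝ≥0∞)) (hf'.indicator hs)
        refine Eq.mp (congrArg Measurable (funext fun x => ?_)) h
        rw [← ρ.lintegral_toKernel x (hf'.indicator hs), lintegral_indicator hs] }
  have hκ : ∀ x, κ x = (ρ.toKernel x).withDensity fun z => (f z : ℝ≥0∞) := fun _ => rfl
  have : IsFiniteKernel κ := ⟨⟨1, ENNReal.one_lt_top, fun x => by
    rw [hκ, withDensity_apply _ MeasurableSet.univ, setLIntegral_univ,
      ρ.lintegral_toKernel x hf', hint x]⟩⟩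
  have hinv : Measurable (Function.uncurry fun (_ : X) (z : Z) => (((f z)⁻¹ : ℝ≥0) : ℝ≥0∞)) :=
    (hf.inv.coe_nnreal_ennreal).comp measurable_snd
  have h : ρ.toKernel = Kernel.withDensity κ fun _ z => (((f z)⁻¹ : ℝ≥0) : ℝ≥0∞) := by
    ext1 x
    rw [Kernel.withDensity_apply _ hinv, hκ]
    have h2 : (fun z => (((f z)⁻¹ : ℝ≥0) : ℝ≥0∞)) = fun z => (f z : ℝ≥0∞)⁻¹ := by
      ext z
      rw [ENNReal.coe_inv (hpos z).ne']
    rw [h2, withDensity_inv_same hf']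
    · exact Filter.Eventually.of_forall fun z => by simpa using (hpos z).ne'
    · exact Filter.Eventually.of_forall fun z => ENNReal.coe_ne_top
  rw [h]
  exact Kernel.IsSFiniteKernel.withDensity κ fun _ _ => ENNReal.coe_ne_top

/-! ### Borel groupoids, Haar systems, quasi-invariant measures -/

/-- A Borel groupoid with arrow space `G` and unit space `G⁰ = U`; the product `mul g h` is
defined when `s g = r h`, and all operations are Borel. (The spaces are assumed standard where
this structure is used.) -/
structure BorelGroupoid (U : Type u) (G : Type v) [MeasurableSpace U] [MeasurableSpace G] where
  r : G → U
  s : G → U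
  one : U → G
  inv : G → G
  mul : ∀ g h : G, s g = r h → G
  r_one : ∀ x, r (one x) = x
  s_one : ∀ x, s (one x) = x
  r_inv : ∀ g, r (inv g) = s g
  s_inv : ∀ g, s (inv g) = r g
  r_mul : ∀ g h e, r (mul g h e) = r g
  s_mul : ∀ g h e, s (mul g h e) = s h
  one_mul : ∀ g, mul (one (r g)) g (s_one _) = g
  mul_one : ∀ g, mul g (one (s g)) (r_one _).symm = g
  inv_mul : ∀ g, mul (inv g) g (s_inv g) = one (s g)
  mul_inv : ∀ g, mul g (inv g) (r_inv g).symm = one (r g)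
  mul_assoc : ∀ g h k (e : s g = r h) (e' : s h = r k),
    mul (mul g h e) k ((s_mul g h e).trans e') = mul g (mul h k e') (e.trans (r_mul h k e').symm)
  measurable_r : Measurable r
  measurable_s : Measurable s
  measurable_one : Measurable one
  measurable_inv : Measurable inv
  measurable_mul : Measurable fun q : {q : G × G // s q.1 = r q.2} => mul q.1.1 q.1.2 q.2

namespace BorelGroupoid

variable {U : Type u} {G : Type v} [MeasurableSpace U] [MeasurableSpace G]

/-- The set `Γ^x_y` of arrows with range `x` and source `y`. -/
abbrev Arr (Γ : BorelGroupoid U G) (x y : U) : Type v := {g : G // Γ.r g = x ∧ Γ.s g = y}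

/-- Left translation by `g : y ⟶ x`, from `Γ^y` onto `Γ^x`. -/
def translate (Γ : BorelGroupoid U G) {x y : U} (g : Γ.Arr x y) (h : Fib Γ.r y) : Fib Γ.r x :=
  ⟨Γ.mul g.1 h.1 (g.2.2.trans h.2.symm), (Γ.r_mul _ _ _).trans g.2.1⟩

theorem measurable_translate (Γ : BorelGroupoid U G) {x y : U} (g : Γ.Arr x y) :
    Measurable (Γ.translate g) := by
  refine Measurable.subtype_mk ?_
  have : Measurable fun h : Fib Γ.r y =>
      (⟨(g.1, h.1), g.2.2.trans h.2.symm⟩ : {q : G × G // Γ.s q.1 = Γ.r q.2}) :=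
    (measurable_const.prodMk measurable_subtype_coe).subtype_mk
  exact Γ.measurable_mul.comp this

/-- Composition of arrows `y ⟶ x` and `z ⟶ y`. -/
def comp (Γ : BorelGroupoid U G) {x y z : U} (g : Γ.Arr x y) (h : Γ.Arr y z) : Γ.Arr x z :=
  ⟨Γ.mul g.1 h.1 (g.2.2.trans h.2.1.symm),
    (Γ.r_mul _ _ _).trans g.2.1, (Γ.s_mul _ _ _).trans h.2.2⟩

/-- Inversion of arrows. -/
def symm (Γ : BorelGroupoid U G) {x y : U} (g : Γ.Arr x y) : Γ.Arr y x :=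
  ⟨Γ.inv g.1, (Γ.r_inv _).trans g.2.2, (Γ.s_inv _).trans g.2.1⟩

/-- A Haar system: a proper Borel system of measures for `r`, invariant under left translation. -/
structure HaarSystem (Γ : BorelGroupoid U G) extends BorelSystem Γ.r where
  proper : toBorelSystem.IsProper
  invariant : ∀ (x y : U) (g : Γ.Arr x y), (meas y).map (Γ.translate g) = meas x

/-- `μ` is quasi-invariant: `μ ∘ lam` is equivalent to its image under inversion. -/
def QuasiInvariant (Γ : BorelGroupoid U G) (lam : Γ.HaarSystem) (μ : Measure U) : Prop :=
  lam.integrate μ ≪ (lam.integrate μ).map Γ.inv ∧ (lam.integrate μ).map Γ.inv ≪ lam.integrate μ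

/-- Ergodicity: every invariant Borel set of units is null or conull. -/
def IsErgodic (Γ : BorelGroupoid U G) (μ : Measure U) : Prop :=
  ∀ A : Set U, MeasurableSet A → (∀ g, Γ.r g ∈ A ↔ Γ.s g ∈ A) → μ A = 0 ∨ μ Aᶜ = 0

end BorelGroupoid

/-! ### Actions and semi-direct groupoids -/

/-- A left Borel `Γ`-space `X`; `act g x` is defined when `s g = anchor x`. -/
structure GSpace {U : Type u} {G : Type v} [MeasurableSpace U] [MeasurableSpace G]
    (Γ : BorelGroupoid U G) (X : Type w) [MeasurableSpace X] where
  anchor : X → U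
  measurable_anchor : Measurable anchor
  surjective_anchor : Function.Surjective anchor
  act : ∀ (g : G) (x : X), Γ.s g = anchor x → X
  measurable_act :
    Measurable fun q : {q : G × X // Γ.s q.1 = anchor q.2} => act q.1.1 q.1.2 q.2
  anchor_act : ∀ g x e, anchor (act g x e) = Γ.r g
  one_act : ∀ x, act (Γ.one (anchor x)) x (Γ.s_one _) = x
  mul_act : ∀ (g h : G) (x : X) (e : Γ.s g = Γ.r h) (e' : Γ.s h = anchor x),
    act (Γ.mul g h e) x ((Γ.s_mul g h e).trans e') = act g (act h x e') (e.trans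
      (anchor_act h x e').symm)

namespace GSpace

variable {U : Type u} {G : Type v} {X : Type w} [MeasurableSpace U] [MeasurableSpace G]
  [MeasurableSpace X] {Γ : BorelGroupoid U G}

/-- The space `X ⋊ Γ = {(x, g) : anchor x = r g}`. -/
abbrev SD (E : GSpace Γ X) : Type _ := {a : X × G // E.anchor a.1 = Γ.r a.2}

/-- The source `g⁻¹ x` of `(x, g)`. -/
def src (E : GSpace Γ X) (a : E.SD) : X :=
  E.act (Γ.inv a.1.2) a.1.1 ((Γ.s_inv _).trans a.2.symm)

theorem anchor_src (E : GSpace Γ X) (a : E.SD) : E.anchor (E.src a) = Γ.s a.1.2 :=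
  (E.anchor_act _ _ _).trans (Γ.r_inv _)

theorem act_congr (E : GSpace Γ X) {g g' : G} {x x' : X} (hg : g = g') (hx : x = x')
    (e : Γ.s g = E.anchor x) (e' : Γ.s g' = E.anchor x') : E.act g x e = E.act g' x' e' := by
  subst hg hx; rfl

end GSpace

theorem BorelGroupoid.mul_congr {U : Type u} {G : Type v} [MeasurableSpace U] [MeasurableSpace G]
    (Γ : BorelGroupoid U G) {g g' h h' : G} (hg : g = g') (hh : h = h')
    (e : Γ.s g = Γ.r h) (e' : Γ.s g' = Γ.r h') : Γ.mul g h e = Γ.mul g' h' e' := by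
  subst hg hh; rfl

theorem BorelGroupoid.mul_left_cancel {U : Type u} {G : Type v} [MeasurableSpace U]
    [MeasurableSpace G] (Γ : BorelGroupoid U G) {g h h' : G}
    (e : Γ.s g = Γ.r h) (e' : Γ.s g = Γ.r h') (H : Γ.mul g h e = Γ.mul g h' e') : h = h' := by
  have key : ∀ k (ek : Γ.s g = Γ.r k),
      Γ.mul (Γ.inv g) (Γ.mul g k ek) ((Γ.s_inv g).trans (Γ.r_mul _ _ _).symm) = k := by
    intro k ek
    rw [← Γ.mul_assoc (Γ.inv g) g k (Γ.s_inv g) ek,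
      Γ.mul_congr ((Γ.inv_mul g).trans (congrArg Γ.one ek)) rfl _ (Γ.s_one _), Γ.one_mul]
  rw [← key h e, ← key h' e']
  exact Γ.mul_congr rfl H _ _

theorem BorelGroupoid.inv_inv {U : Type u} {G : Type v} [MeasurableSpace U] [MeasurableSpace G]
    (Γ : BorelGroupoid U G) (g : G) : Γ.inv (Γ.inv g) = g := by
  refine Γ.mul_left_cancel (g := Γ.inv g) (Γ.r_inv _).symm (Γ.s_inv _) ?_
  rw [Γ.mul_inv, Γ.inv_mul, Γ.r_inv]

theorem BorelGroupoid.inv_one {U : Type u} {G : Type v} [MeasurableSpace U] [MeasurableSpace G]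
    (Γ : BorelGroupoid U G) (x : U) : Γ.inv (Γ.one x) = Γ.one x := by
  refine Γ.mul_left_cancel (g := Γ.one x) (Γ.r_inv _).symm ((Γ.s_one x).trans (Γ.r_one x).symm) ?_
  rw [Γ.mul_inv]
  have := Γ.mul_one (Γ.one x)
  rw [Γ.mul_congr rfl (congrArg Γ.one (Γ.s_one x)) _ ((Γ.s_one x).trans (Γ.r_one x).symm)] at this
  rw [this, Γ.r_one]

theorem BorelGroupoid.inv_mul_rev {U : Type u} {G : Type v} [MeasurableSpace U]
    [MeasurableSpace G] (Γ : BorelGroupoid U G) (g h : G) (e : Γ.s g = Γ.r h) :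
    Γ.inv (Γ.mul g h e) = Γ.mul (Γ.inv h) (Γ.inv g) ((Γ.s_inv h).trans (e.symm.trans
      (Γ.r_inv g).symm)) := by
  have e1 : Γ.s h = Γ.r (Γ.inv h) := (Γ.r_inv h).symm
  have e2 : Γ.s (Γ.inv h) = Γ.r (Γ.inv g) := (Γ.s_inv h).trans (e.symm.trans (Γ.r_inv g).symm)
  refine Γ.mul_left_cancel (g := Γ.mul g h e) (Γ.r_inv _).symm
    ((Γ.s_mul _ _ _).trans (e1.trans (Γ.r_mul _ _ e2).symm)) ?_
  rw [Γ.mul_inv, Γ.r_mul, Γ.mul_assoc g h _ e (e1.trans (Γ.r_mul _ _ e2).symm)]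
  have h3 : Γ.mul h (Γ.mul (Γ.inv h) (Γ.inv g) e2) (e1.trans (Γ.r_mul _ _ e2).symm)
      = Γ.inv g := by
    rw [← Γ.mul_assoc h (Γ.inv h) (Γ.inv g) e1 e2]
    rw [Γ.mul_congr ((Γ.mul_inv h).trans (congrArg Γ.one (e.symm.trans (Γ.r_inv g).symm))) rfl _
      (Γ.s_one _), Γ.one_mul]
  rw [Γ.mul_congr rfl h3 _ (Γ.r_inv g).symm, Γ.mul_inv]

namespace GSpace

variable {U : Type u} {G : Type v} {X : Type w} [MeasurableSpace U] [MeasurableSpace G]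
  [MeasurableSpace X] {Γ : BorelGroupoid U G}

theorem measurable_src (E : GSpace Γ X) : Measurable E.src := by
  have : Measurable fun a : E.SD =>
      (⟨(Γ.inv a.1.2, a.1.1), (Γ.s_inv _).trans a.2.symm⟩ :
        {q : G × X // Γ.s q.1 = E.anchor q.2}) :=
    ((Γ.measurable_inv.comp measurable_subtype_coe.snd).prodMk
      measurable_subtype_coe.fst).subtype_mk
  exact E.measurable_act.comp this

/-- The semi-direct groupoid `X ⋊ Γ`, with unit space `X`:
`r (x, g) = x`, `s (x, g) = g⁻¹ x`, `(x, g) (g⁻¹ x, h) = (x, g h)`. -/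
def semidirect (E : GSpace Γ X) : BorelGroupoid X E.SD where
  r a := a.1.1
  s := E.src
  one x := ⟨(x, Γ.one (E.anchor x)), (Γ.r_one _).symm⟩
  inv a := ⟨(E.src a, Γ.inv a.1.2), (E.anchor_src a).trans (Γ.r_inv _).symm⟩
  mul a b e := ⟨(a.1.1, Γ.mul a.1.2 b.1.2
      ((E.anchor_src a).symm.trans ((congrArg E.anchor e).trans b.2))),
    a.2.trans (Γ.r_mul _ _ _).symm⟩
  r_one _ := rfl
  s_one x := by
    change E.act (Γ.inv (Γ.one (E.anchor x))) x _ = x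
    rw [E.act_congr (Γ.inv_one _) rfl _ (Γ.s_one _), E.one_act]
  r_inv _ := rfl
  s_inv a := by
    change E.act (Γ.inv (Γ.inv a.1.2)) (E.act (Γ.inv a.1.2) a.1.1 _) _ = a.1.1
    rw [← E.mul_act (Γ.inv (Γ.inv a.1.2)) (Γ.inv a.1.2) a.1.1 (Γ.s_inv _)]
    rw [E.act_congr (g' := Γ.one (E.anchor a.1.1)) ?_ rfl _ (Γ.s_one _), E.one_act]
    rw [Γ.inv_mul, Γ.s_inv, a.2]
  r_mul _ _ _ := rfl
  s_mul a b e := by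
    have e1 : Γ.s a.1.2 = Γ.r b.1.2 :=
      (E.anchor_src a).symm.trans ((congrArg E.anchor e).trans b.2)
    have e2 : Γ.s (Γ.inv b.1.2) = Γ.r (Γ.inv a.1.2) :=
      (Γ.s_inv _).trans (e1.symm.trans (Γ.r_inv _).symm)
    have e3 : Γ.s (Γ.inv a.1.2) = E.anchor a.1.1 := (Γ.s_inv _).trans a.2.symm
    change E.act (Γ.inv (Γ.mul a.1.2 b.1.2 e1)) a.1.1 _ = E.act (Γ.inv b.1.2) b.1.1 _
    rw [E.act_congr (Γ.inv_mul_rev a.1.2 b.1.2 e1) rfl _ ((Γ.s_mul _ _ e2).trans e3),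
      E.mul_act _ _ _ e2 e3]
    exact E.act_congr rfl e _ _
  one_mul a := by
    refine Subtype.ext (Prod.ext rfl ?_)
    change Γ.mul (Γ.one (E.anchor a.1.1)) a.1.2 _ = a.1.2
    rw [Γ.mul_congr (congrArg Γ.one a.2) rfl _ (Γ.s_one _), Γ.one_mul]
  mul_one a := by
    refine Subtype.ext (Prod.ext rfl ?_)
    change Γ.mul a.1.2 (Γ.one (E.anchor (E.src a))) _ = a.1.2
    rw [Γ.mul_congr rfl (congrArg Γ.one (E.anchor_src a)) _ (Γ.r_one _).symm, Γ.mul_one]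
  inv_mul a := by
    refine Subtype.ext (Prod.ext rfl ?_)
    change Γ.mul (Γ.inv a.1.2) a.1.2 _ = Γ.one (E.anchor (E.src a))
    rw [Γ.inv_mul, E.anchor_src]
  mul_inv a := by
    refine Subtype.ext (Prod.ext rfl ?_)
    change Γ.mul a.1.2 (Γ.inv a.1.2) _ = Γ.one (E.anchor a.1.1)
    rw [Γ.mul_inv, a.2]
  mul_assoc a b c e e' := by
    refine Subtype.ext (Prod.ext rfl ?_)
    exact Γ.mul_assoc a.1.2 b.1.2 c.1.2 _ _
  measurable_r := measurable_subtype_coe.fst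
  measurable_s := E.measurable_src
  measurable_one :=
    (measurable_id.prodMk (Γ.measurable_one.comp E.measurable_anchor)).subtype_mk
  measurable_inv :=
    (E.measurable_src.prodMk (Γ.measurable_inv.comp measurable_subtype_coe.snd)).subtype_mk
  measurable_mul := by
    refine Measurable.subtype_mk (Measurable.prodMk ?_ ?_)
    · exact (measurable_subtype_coe.comp measurable_subtype_coe.fst).fst
    · have : Measurable fun q : {q : E.SD × E.SD // E.src q.1 = q.2.1.1} =>
          (⟨(q.1.1.1.2, q.1.2.1.2),
            (E.anchor_src q.1.1).symm.trans ((congrArg E.anchor q.2).trans q.1.2.2)⟩ :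
            {q : G × G // Γ.s q.1 = Γ.r q.2}) :=
        (((measurable_subtype_coe.comp measurable_subtype_coe.fst).snd).prodMk
          ((measurable_subtype_coe.comp measurable_subtype_coe.snd).snd)).subtype_mk
      exact Γ.measurable_mul.comp this

/-- The map `g ↦ (x, g)` from `Γ^(anchor x)` onto `(X ⋊ Γ)^x`. -/
def incl (E : GSpace Γ X) (x : X) (g : Fib Γ.r (E.anchor x)) : Fib E.semidirect.r x :=
  ⟨⟨(x, g.1), g.2.symm⟩, rfl⟩

theorem measurable_incl (E : GSpace Γ X) (x : X) : Measurable (E.incl x) :=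
  ((measurable_const.prodMk measurable_subtype_coe).subtype_mk).subtype_mk

theorem measurableSet_SD [StandardBorelSpace U] (E : GSpace Γ X) :
    MeasurableSet {a : X × G | E.anchor a.1 = Γ.r a.2} :=
  measurableSet_eq_fun (E.measurable_anchor.comp measurable_fst)
    (Γ.measurable_r.comp measurable_snd)

/-- The Haar system `δ_x × lam^(anchor x)` of `X ⋊ Γ`. -/
def semidirectHaar [StandardBorelSpace U] (E : GSpace Γ X) (lam : Γ.HaarSystem) :
    E.semidirect.HaarSystem where
  meas x := (lam.meas (E.anchor x)).map (E.incl x)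
  borel f hf := by
    have := lam.isSFiniteKernel lam.proper
    obtain ⟨F, hF, hFf⟩ := (MeasurableEmbedding.subtype_coe
      (E.measurableSet_SD)).exists_measurable_extend hf fun _ => ⟨0⟩
    have h1 : Measurable fun x => ∫⁻ g, F (x, g) ∂(lam.toKernel.comap E.anchor
        E.measurable_anchor x) := hF.lintegral_kernel_prod_right'
    refine Eq.mp (congrArg Measurable (funext fun x => ?_)) h1
    rw [Kernel.comap_apply,
      lam.lintegral_toKernel (E.anchor x) (f := fun g => F (x, g)) (by fun_prop),
      lintegral_map (f := fun z : Fib E.semidirect.r x => f z.1)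
        (hf.comp measurable_subtype_coe) (E.measurable_incl x)]
    refine lintegral_congr fun g => ?_
    exact congrFun hFf (E.incl x g).1
  proper := by
    obtain ⟨f, hf, hpos, hint⟩ := lam.proper
    refine ⟨fun a => f a.1.2, hf.comp measurable_subtype_coe.snd, fun a => hpos _, fun x => ?_⟩
    rw [lintegral_map ?_ (E.measurable_incl x)]
    · exact hint (E.anchor x)
    · exact (hf.comp
        (measurable_subtype_coe.comp measurable_subtype_coe).snd).coe_nnreal_ennreal
  invariant x y a := by
    have h : Γ.r a.1.1.2 = E.anchor x ∧ Γ.s a.1.1.2 = E.anchor y :=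
      ⟨a.1.2.symm.trans (congrArg E.anchor a.2.1),
        (E.anchor_src a.1).symm.trans (congrArg E.anchor a.2.2)⟩
    rw [← lam.invariant (E.anchor x) (E.anchor y) ⟨a.1.1.2, h⟩,
      Measure.map_map (E.measurable_incl x) (Γ.measurable_translate _),
      Measure.map_map (E.semidirect.measurable_translate a) (E.measurable_incl y)]
    congr 1
    funext g
    exact Subtype.ext (Subtype.ext (Prod.ext a.2.1 rfl))

end GSpace

/-! ### Hilbert bundles -/

/-- A (real or complex) Hilbert bundle over the Borel space `X`: a family of Hilbert spaces
together with a standard Borel structure on the total space `X * H`, and a fundamental sequence of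
Borel sections. -/
structure HilbertBundle (𝕜 : Type*) [RCLike 𝕜] (X : Type u) [MeasurableSpace X] where
  fibre : X → Type w
  [group : ∀ x, NormedAddCommGroup (fibre x)]
  [hilbert : ∀ x, InnerProductSpace 𝕜 (fibre x)]
  [complete : ∀ x, CompleteSpace (fibre x)]
  borel : MeasurableSpace (Σ x, fibre x)
  standard : @StandardBorelSpace (Σ x, fibre x) borel
  measurableSet_iff : ∀ A : Set X,
    MeasurableSet A ↔ MeasurableSet[borel] ((Sigma.fst : (Σ x, fibre x) → X) ⁻¹' A)
  fund : ℕ → ∀ x, fibre x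
  fund_section : ∀ n, Measurable[_, borel] fun x => (⟨x, fund n x⟩ : Σ x, fibre x)
  fund_inner : ∀ n, Measurable[borel] fun v : (Σ x, fibre x) => inner 𝕜 (fund n v.1) v.2
  fund_gram : ∀ m n, Measurable fun x => inner 𝕜 (fund m x) (fund n x)
  fund_separates : ∀ (x : X) (v w : fibre x),
    (∀ n, inner 𝕜 (fund n x) v = inner 𝕜 (fund n x) w) → v = w

attribute [instance] HilbertBundle.group HilbertBundle.hilbert HilbertBundle.complete

namespace HilbertBundle

variable {𝕜 : Type*} [RCLike 𝕜] {X : Type u} [MeasurableSpace X]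

/-- The total space `X * H`. -/
def Total (H : HilbertBundle 𝕜 X) : Type _ := Σ x, H.fibre x

instance (H : HilbertBundle 𝕜 X) : MeasurableSpace H.Total := H.borel

instance (H : HilbertBundle 𝕜 X) : StandardBorelSpace H.Total := H.standard

/-- The vector `v` over `x`, as a point of the total space. -/
def pt (H : HilbertBundle 𝕜 X) (x : X) (v : H.fibre x) : H.Total := ⟨x, v⟩

/-- A Borel section of the bundle. -/
def IsBorelSection (H : HilbertBundle 𝕜 X) (ξ : ∀ x, H.fibre x) : Prop :=
  Measurable fun x => H.pt x (ξ x)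

theorem measurable_proj (H : HilbertBundle 𝕜 X) : Measurable fun v : H.Total => v.1 :=
  fun A hA => (H.measurableSet_iff A).1 hA

theorem measurableEmbedding_coord [StandardBorelSpace X] (H : HilbertBundle 𝕜 X) :
    MeasurableEmbedding fun v : H.Total => (v.1, fun n => inner 𝕜 (H.fund n v.1) v.2) := by
  refine Measurable.measurableEmbedding ?_ ?_
  · exact H.measurable_proj.prodMk (measurable_pi_iff.2 fun n => H.fund_inner n)
  · rintro ⟨x, v⟩ ⟨y, w⟩ h
    obtain ⟨h1, h2⟩ := Prod.ext_iff.1 h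
    dsimp only at h1 h2
    subst h1
    rw [H.fund_separates x v w fun n => congrFun h2 n]

theorem measurable_pt_iff [StandardBorelSpace X] (H : HilbertBundle 𝕜 X) {Ω : Type*}
    [MeasurableSpace Ω] (x : Ω → X) (v : ∀ ω, H.fibre (x ω)) :
    Measurable (fun ω => H.pt (x ω) (v ω)) ↔
      Measurable x ∧ ∀ n, Measurable fun ω => inner 𝕜 (H.fund n (x ω)) (v ω) := by
  rw [← H.measurableEmbedding_coord.measurable_comp_iff]
  constructor
  · intro h
    exact ⟨h.fst, fun n => (measurable_pi_apply n).comp h.snd⟩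
  · rintro ⟨h1, h2⟩
    exact h1.prodMk (measurable_pi_iff.2 h2)

variable {Y : Type v}

theorem standardBorelSpace_comap {α : Type*} {β : Type*} [MeasurableSpace β]
    [StandardBorelSpace β] (f : α → β) (hf : Function.Injective f)
    (hr : MeasurableSet (Set.range f)) :
    @StandardBorelSpace α (MeasurableSpace.comap f inferInstance) := by
  have := hr.standardBorel
  obtain ⟨τ, hb, hp⟩ := StandardBorelSpace.polish (α := Set.range f)
  let e : α ≃ Set.range f := Equiv.ofInjective f hf
  refine @StandardBorelSpace.mk α (MeasurableSpace.comap f inferInstance)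
    ⟨τ.induced e, ?_, e.polishSpace_induced⟩
  refine @BorelSpace.mk α (τ.induced e) (MeasurableSpace.comap f inferInstance) ?_
  rw [borel_comap, ← hb.measurable_eq]
  change _ = MeasurableSpace.comap e (MeasurableSpace.comap Subtype.val _)
  rw [MeasurableSpace.comap_comp]
  rfl

/-- The embedding of the total space of `p^* H` in `Y × (X * H)`. -/
def pullEmb (H : HilbertBundle 𝕜 X) (p : Y → X) (v : Σ y, H.fibre (p y)) : Y × H.Total :=
  (v.1, H.pt (p v.1) v.2)

theorem pullEmb_injective (H : HilbertBundle 𝕜 X) (p : Y → X) :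
    Function.Injective (H.pullEmb p) := by
  rintro ⟨y, v⟩ ⟨z, w⟩ h
  obtain ⟨h1, h2⟩ := Prod.ext_iff.1 h
  dsimp only [pullEmb] at h1 h2
  subst h1
  rw [eq_of_heq (Sigma.mk.inj h2).2]

theorem range_pullEmb (H : HilbertBundle 𝕜 X) (p : Y → X) :
    Set.range (H.pullEmb p) = {q | p q.1 = q.2.1} := by
  ext ⟨y, ⟨x, v⟩⟩
  constructor
  · rintro ⟨⟨z, w⟩, h⟩
    obtain ⟨h1, h2⟩ := Prod.ext_iff.1 h
    dsimp only [pullEmb] at h1 h2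
    subst h1
    exact (Sigma.mk.inj h2).1
  · intro h
    change p y = x at h
    subst h
    exact ⟨⟨y, v⟩, rfl⟩

variable [MeasurableSpace Y]

/-- The pull-back `p^* H = {(y, v) : v ∈ H (p y)}`, with the Borel structure of the fibred product
of `Y` and `X * H`. -/
def pullback [StandardBorelSpace X] [StandardBorelSpace Y] (H : HilbertBundle 𝕜 X) (p : Y → X)
    (hp : Measurable p) : HilbertBundle 𝕜 Y where
  fibre y := H.fibre (p y)
  borel := MeasurableSpace.comap (H.pullEmb p) inferInstance
  standard := by
    have hr : MeasurableSet (Set.range (H.pullEmb p)) := by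
      rw [range_pullEmb]
      exact measurableSet_eq_fun (hp.comp measurable_fst) (H.measurable_proj.comp measurable_snd)
    exact standardBorelSpace_comap (H.pullEmb p) (H.pullEmb_injective p) hr
  measurableSet_iff A := by
    have h0 : Measurable fun y => H.pt (p y) 0 :=
      (H.measurable_pt_iff p fun y => 0).2 ⟨hp, fun n => by simp⟩
    constructor
    · intro hA
      exact ⟨Prod.fst ⁻¹' A, measurable_fst hA, rfl⟩
    · rintro ⟨B, hB, hBA⟩
      have : A = (fun y => (y, H.pt (p y) 0)) ⁻¹' B := by
        ext y
        have := Set.ext_iff.1 hBA ⟨y, 0⟩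
        exact this.symm
      rw [this]
      exact (measurable_id.prodMk h0) hB
  fund n y := H.fund n (p y)
  fund_section n := by
    rintro _ ⟨B, hB, rfl⟩
    exact (measurable_id.prodMk
      ((show Measurable fun x => H.pt x (H.fund n x) from H.fund_section n).comp hp)) hB
  fund_inner n := by
    have h : Measurable fun q : Y × H.Total => inner 𝕜 (H.fund n q.2.1) q.2.2 :=
      (show Measurable fun v : H.Total => inner 𝕜 (H.fund n v.1) v.2 from H.fund_inner n).comp
        measurable_snd
    intro B hB
    exact ⟨_, h hB, rfl⟩
  fund_gram m n := (H.fund_gram m n).comp hp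
  fund_separates y v w h := H.fund_separates (p y) v w h

theorem measurable_pullback_pt [StandardBorelSpace X] [StandardBorelSpace Y]
    (H : HilbertBundle 𝕜 X) (p : Y → X) (hp : Measurable p) {Ω : Type*} [MeasurableSpace Ω]
    (y : Ω → Y) (hy : Measurable y) (v : ∀ ω, H.fibre (p (y ω)))
    (hv : Measurable fun ω => H.pt (p (y ω)) (v ω)) :
    Measurable fun ω => (H.pullback p hp).pt (y ω) (v ω) :=
  ((H.pullback p hp).measurable_pt_iff y v).2
    ⟨hy, ((H.measurable_pt_iff (fun ω => p (y ω)) v).1 hv).2⟩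

end HilbertBundle

/-! ### GroupoidReps -/

/-- A representation in the Hilbert bundle `H` of the measured groupoid defined by `Γ`, its Haar
system and the quasi-invariant measure `μ`: a Borel family of operators
`L g : H (s g) → H (r g)` which, on the reduction to a conull Borel set `A` of units, consists of
Hilbert isomorphisms and is multiplicative. -/
structure GroupoidRep {𝕜 : Type*} [RCLike 𝕜] {U : Type u} {G : Type v} [MeasurableSpace U]
    [MeasurableSpace G] (Γ : BorelGroupoid U G) (μ : Measure U)
    (H : HilbertBundle.{u, w} 𝕜 U) where
  op : ∀ x y : U, Γ.Arr x y → (H.fibre y →L[𝕜] H.fibre x)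
  borel : ∀ m n, Measurable fun g : G =>
    inner 𝕜 (H.fund m (Γ.r g)) (op (Γ.r g) (Γ.s g) ⟨g, rfl, rfl⟩ (H.fund n (Γ.s g)))
  strict : ∃ A : Set U, MeasurableSet A ∧ μ Aᶜ = 0 ∧
    (∀ x ∈ A, ∀ y ∈ A, ∀ g : Γ.Arr x y, (∀ v, ‖op x y g v‖ = ‖v‖) ∧
      Function.Surjective (op x y g)) ∧
    (∀ x ∈ A, ∀ y ∈ A, ∀ z ∈ A, ∀ (g : Γ.Arr x y) (h : Γ.Arr y z) (v : H.fibre z),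
      op x z (Γ.comp g h) v = op x y g (op y z h v)) ∧
    (∀ x ∈ A, ∀ y ∈ A, ∀ (g : Γ.Arr x y) (v : H.fibre y),
      op y x (Γ.symm g) (op x y g v) = v)

/-! ### Cocycles, coboundaries and the first cohomology group -/

section Cohomology

variable {𝕜 : Type*} [RCLike 𝕜] {U : Type u} {G : Type v} [MeasurableSpace U]
  [MeasurableSpace G] {Γ : BorelGroupoid U G}

/-- An arrow with range `x`, as an arrow from its source to `x`. -/
def Fib.arr {x : U} (g : Fib Γ.r x) : Γ.Arr x (Γ.s g.1) := ⟨g.1, g.2, rfl⟩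

/-- The arrow underlying `g`, as an element of `Γ^x`. -/
def BorelGroupoid.Arr.fib {x y : U} (g : Γ.Arr x y) : Fib Γ.r x := ⟨g.1, g.2.1⟩

/-- Sections `b` of `r^* H` over the arrow space; `b x g ∈ H x` for `g ∈ Γ^x`. -/
abbrev ArrowSection (Γ : BorelGroupoid U G) (H : HilbertBundle.{u, w} 𝕜 U) :=
  ∀ x : U, Fib Γ.r x → H.fibre x

/-- The section `b` is a Borel map. -/
def ArrowSection.IsBorel {H : HilbertBundle.{u, w} 𝕜 U} (b : ArrowSection Γ H) : Prop :=
  Measurable fun g : G => H.pt (Γ.r g) (b (Γ.r g) ⟨g, rfl⟩)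

/-- Almost everywhere `L`-cocycles: `b (γ₁⁻¹ γ₂) = b (γ₁⁻¹) + L (γ₁⁻¹) b (γ₂)` for almost every
pair with respect to the measure `f ↦ ∫∫∫ f (γ₁⁻¹, γ₂) dlam^x(γ₁) dlam^x(γ₂) dμ(x)` on the set of
composable pairs. -/
def IsAECocycle (lam : Γ.HaarSystem) (μ : Measure U) {H : HilbertBundle.{u, w} 𝕜 U}
    (L : GroupoidRep Γ μ H) (b : ArrowSection Γ H) : Prop :=
  ∀ᵐ x ∂μ, ∀ᵐ g₂ ∂(lam.meas x), ∀ᵐ g₁ ∂(lam.meas x),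
    b (Γ.s g₁.1) (Γ.comp (Γ.symm g₁.arr) g₂.arr).fib =
      b (Γ.s g₁.1) (Γ.symm g₁.arr).fib + L.op _ _ (Γ.symm g₁.arr) (b x g₂)

/-- Equality almost everywhere with respect to `μ ∘ lam = ∫ lam^x dμ(x)`. -/
def ArrowSection.AEEq (lam : Γ.HaarSystem) (μ : Measure U) {H : HilbertBundle.{u, w} 𝕜 U}
    (b c : ArrowSection Γ H) : Prop :=
  ∀ᵐ x ∂μ, ∀ᵐ g ∂(lam.meas x), b x g = c x g

/-- The coboundary `γ ↦ ξ (r γ) - L γ (ξ (s γ))`. -/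
def coboundary {μ : Measure U} {H : HilbertBundle.{u, w} 𝕜 U} (L : GroupoidRep Γ μ H)
    (ξ : ∀ x, H.fibre x) : ArrowSection Γ H :=
  fun x g => ξ x - L.op x (Γ.s g.1) g.arr (ξ (Γ.s g.1))

variable [StandardBorelSpace U]

/-- The space of Borel almost everywhere `L`-cocycles. -/
def cocycles (lam : Γ.HaarSystem) (μ : Measure U) {H : HilbertBundle.{u, w} 𝕜 U}
    (L : GroupoidRep Γ μ H) : Submodule 𝕜 (ArrowSection Γ H) where
  carrier := {b | b.IsBorel ∧ IsAECocycle lam μ L b}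
  zero_mem' := by
    refine ⟨(H.measurable_pt_iff _ _).2 ⟨Γ.measurable_r, fun n => ?_⟩, ?_⟩
    · simp
    · exact Filter.Eventually.of_forall fun x => Filter.Eventually.of_forall fun g₂ =>
        Filter.Eventually.of_forall fun g₁ => by simp
  add_mem' := by
    rintro b c ⟨hb, hb'⟩ ⟨hc, hc'⟩
    refine ⟨(H.measurable_pt_iff _ _).2 ⟨Γ.measurable_r, fun n => ?_⟩, ?_⟩
    · simp only [Pi.add_apply, inner_add_right]
      exact (((H.measurable_pt_iff _ _).1 hb).2 n).add (((H.measurable_pt_iff _ _).1 hc).2 n)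
    · filter_upwards [hb', hc'] with x hbx hcx
      filter_upwards [hbx, hcx] with g₂ hb₂ hc₂
      filter_upwards [hb₂, hc₂] with g₁ hb₁ hc₁
      simp only [Pi.add_apply, map_add, hb₁, hc₁]
      abel
  smul_mem' := by
    rintro k b ⟨hb, hb'⟩
    refine ⟨(H.measurable_pt_iff _ _).2 ⟨Γ.measurable_r, fun n => ?_⟩, ?_⟩
    · simp only [Pi.smul_apply, inner_smul_right]
      exact (((H.measurable_pt_iff _ _).1 hb).2 n).const_mul k
    · filter_upwards [hb'] with x hbx
      filter_upwards [hbx] with g₂ hb₂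
      filter_upwards [hb₂] with g₁ hb₁
      simp only [Pi.smul_apply, map_smul, hb₁, smul_add]

/-- The cocycles that vanish almost everywhere. -/
def nullCocycles (lam : Γ.HaarSystem) (μ : Measure U) {H : HilbertBundle.{u, w} 𝕜 U}
    (L : GroupoidRep Γ μ H) : Submodule 𝕜 (cocycles lam μ L) where
  carrier := {b | ArrowSection.AEEq lam μ b.1 0}
  zero_mem' := by
    change ArrowSection.AEEq lam μ _ _
    exact Filter.Eventually.of_forall fun _ => Filter.Eventually.of_forall fun _ => rfl
  add_mem' := by
    intro b c hb hc
    change ArrowSection.AEEq lam μ _ _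
    filter_upwards [hb, hc] with x hbx hcx
    filter_upwards [hbx, hcx] with g hbg hcg
    simp [hbg, hcg]
  smul_mem' := by
    intro k b hb
    change ArrowSection.AEEq lam μ _ _
    filter_upwards [hb] with x hbx
    filter_upwards [hbx] with g hbg
    simp [hbg]

/-- `Z¹`: the space of classes of almost everywhere `L`-cocycles modulo almost everywhere
equality. -/
abbrev Z1 (lam : Γ.HaarSystem) (μ : Measure U) {H : HilbertBundle.{u, w} 𝕜 U}
    (L : GroupoidRep Γ μ H) :=
  cocycles lam μ L ⧸ nullCocycles lam μ L

/-- The cocycles that are `L`-coboundaries, that is, almost everywhere equal to the coboundary of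
a Borel section. -/
def coboundaries (lam : Γ.HaarSystem) (μ : Measure U) {H : HilbertBundle.{u, w} 𝕜 U}
    (L : GroupoidRep Γ μ H) : Submodule 𝕜 (cocycles lam μ L) where
  carrier := {b | ∃ ξ, H.IsBorelSection ξ ∧ ArrowSection.AEEq lam μ b.1 (coboundary L ξ)}
  zero_mem' := by
    refine ⟨0, (H.measurable_pt_iff _ _).2 ⟨measurable_id, fun n => by simp⟩, ?_⟩
    exact Filter.Eventually.of_forall fun _ => Filter.Eventually.of_forall fun _ => by
      simp [coboundary]
  add_mem' := by
    rintro b c ⟨ξ, hξ, hb⟩ ⟨η, hη, hc⟩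
    refine ⟨ξ + η, (H.measurable_pt_iff _ _).2 ⟨measurable_id, fun n => ?_⟩, ?_⟩
    · simp only [Pi.add_apply, inner_add_right]
      exact (((H.measurable_pt_iff _ _).1 hξ).2 n).add (((H.measurable_pt_iff _ _).1 hη).2 n)
    · filter_upwards [hb, hc] with x hbx hcx
      filter_upwards [hbx, hcx] with g hbg hcg
      simp only [Submodule.coe_add, Pi.add_apply, hbg, hcg, coboundary, map_add]
      abel
  smul_mem' := by
    rintro k b ⟨ξ, hξ, hb⟩
    refine ⟨k • ξ, (H.measurable_pt_iff _ _).2 ⟨measurable_id, fun n => ?_⟩, ?_⟩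
    · simp only [Pi.smul_apply, inner_smul_right]
      exact (((H.measurable_pt_iff _ _).1 hξ).2 n).const_mul k
    · filter_upwards [hb] with x hbx
      filter_upwards [hbx] with g hbg
      simp only [Submodule.coe_smul, Pi.smul_apply, hbg, coboundary, map_smul, smul_sub]

/-- `B¹`: the space of classes of `L`-coboundaries. -/
def B1 (lam : Γ.HaarSystem) (μ : Measure U) {H : HilbertBundle.{u, w} 𝕜 U}
    (L : GroupoidRep Γ μ H) : Submodule 𝕜 (Z1 lam μ L) :=
  (coboundaries lam μ L).map (nullCocycles lam μ L).mkQ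

/-- `H¹ = Z¹ / B¹`: the first cohomology group with respect to `L`. -/
abbrev H1 (lam : Γ.HaarSystem) (μ : Measure U) {H : HilbertBundle.{u, w} 𝕜 U}
    (L : GroupoidRep Γ μ H) :=
  Z1 lam μ L ⧸ B1 lam μ L

end Cohomology

/-! ### Functoriality -/

/-- A (strict) Borel homomorphism of Borel groupoids. -/
structure BorelHom {U : Type*} {G : Type*} {U' : Type*} {G' : Type*} [MeasurableSpace U]
    [MeasurableSpace G] [MeasurableSpace U'] [MeasurableSpace G']
    (Δ : BorelGroupoid U' G') (Γ : BorelGroupoid U G) where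
  unit : U' → U
  toFun : G' → G
  measurable_unit : Measurable unit
  measurable_toFun : Measurable toFun
  map_r : ∀ g, Γ.r (toFun g) = unit (Δ.r g)
  map_s : ∀ g, Γ.s (toFun g) = unit (Δ.s g)
  map_one : ∀ x, toFun (Δ.one x) = Γ.one (unit x)
  map_inv : ∀ g, toFun (Δ.inv g) = Γ.inv (toFun g)
  map_mul : ∀ g h e, toFun (Δ.mul g h e) =
    Γ.mul (toFun g) (toFun h) ((map_s g).trans ((congrArg unit e).trans (map_r h).symm))

namespace BorelHom

variable {𝕜 : Type*} [RCLike 𝕜] {U : Type*} {G : Type*} {U' : Type*} {G' : Type*}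
  [MeasurableSpace U] [MeasurableSpace G] [MeasurableSpace U'] [MeasurableSpace G']
  {Δ : BorelGroupoid U' G'} {Γ : BorelGroupoid U G}

/-- The action of a homomorphism on `Δ^x_y`. -/
def arr (φ : BorelHom Δ Γ) {x y : U'} (g : Δ.Arr x y) : Γ.Arr (φ.unit x) (φ.unit y) :=
  ⟨φ.toFun g.1, (φ.map_r _).trans (congrArg φ.unit g.2.1),
    (φ.map_s _).trans (congrArg φ.unit g.2.2)⟩

/-- The action of a homomorphism on `Δ^x`. -/
def fib (φ : BorelHom Δ Γ) (x : U') (g : Fib Δ.r x) : Fib Γ.r (φ.unit x) :=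
  ⟨φ.toFun g.1, (φ.map_r _).trans (congrArg φ.unit g.2)⟩

theorem measurable_fib (φ : BorelHom Δ Γ) (x : U') : Measurable (φ.fib x) :=
  (φ.measurable_toFun.comp measurable_subtype_coe).subtype_mk

theorem arr_comp (φ : BorelHom Δ Γ) {x y z : U'} (g : Δ.Arr x y) (h : Δ.Arr y z) :
    φ.arr (Δ.comp g h) = Γ.comp (φ.arr g) (φ.arr h) :=
  Subtype.ext (φ.map_mul _ _ _)

theorem arr_symm (φ : BorelHom Δ Γ) {x y : U'} (g : Δ.Arr x y) :
    φ.arr (Δ.symm g) = Γ.symm (φ.arr g) :=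
  Subtype.ext (φ.map_inv _)

/-- `φ` carries the Haar system of `Δ` to that of `Γ`, fibre by fibre. -/
def PreservesHaar (φ : BorelHom Δ Γ) (lam' : Δ.HaarSystem) (lam : Γ.HaarSystem) : Prop :=
  ∀ x, (lam'.meas x).map (φ.fib x) = lam.meas (φ.unit x)

theorem ae_pull (φ : BorelHom Δ Γ) {lam' : Δ.HaarSystem} {lam : Γ.HaarSystem}
    (hlam : φ.PreservesHaar lam' lam) (x : U') {P : Fib Γ.r (φ.unit x) → Prop}
    (h : ∀ᵐ g ∂(lam.meas (φ.unit x)), P g) : ∀ᵐ g ∂(lam'.meas x), P (φ.fib x g) := by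
  rw [← hlam x] at h
  exact ae_of_ae_map (φ.measurable_fib x).aemeasurable h

variable [StandardBorelSpace U] [StandardBorelSpace U']

/-- The representation `L ∘ φ` in the pull-back bundle. -/
def pullRep (φ : BorelHom Δ Γ) {μ' : Measure U'} {μ : Measure U}
    (hφ : Measure.QuasiMeasurePreserving φ.unit μ' μ) {H : HilbertBundle 𝕜 U}
    (L : GroupoidRep Γ μ H) :
    GroupoidRep Δ μ' (H.pullback φ.unit φ.measurable_unit) where
  op x y g := L.op (φ.unit x) (φ.unit y) (φ.arr g)
  borel m n := by
    have key : ∀ (g : G) (x y : U) (h : Γ.r g = x ∧ Γ.s g = y),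
        inner 𝕜 (H.fund m x) (L.op x y ⟨g, h⟩ (H.fund n y)) =
        inner 𝕜 (H.fund m (Γ.r g)) (L.op (Γ.r g) (Γ.s g) ⟨g, rfl, rfl⟩ (H.fund n (Γ.s g))) := by
      rintro g _ _ ⟨rfl, rfl⟩
      rfl
    refine Eq.mp (congrArg Measurable (funext fun g => ?_))
      ((L.borel m n).comp φ.measurable_toFun)
    exact (key (φ.toFun g) _ _ ⟨φ.map_r g, φ.map_s g⟩).symm
  strict := by
    obtain ⟨A, hA, hμ, h1, h2, h3⟩ := L.strict
    refine ⟨φ.unit ⁻¹' A, φ.measurable_unit hA, hφ.preimage_null hμ, ?_, ?_, ?_⟩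
    · intro x hx y hy g
      exact h1 _ hx _ hy (φ.arr g)
    · intro x hx y hy z hz g h w
      rw [φ.arr_comp]
      exact h2 _ hx _ hy _ hz (φ.arr g) (φ.arr h) w
    · intro x hx y hy g w
      rw [φ.arr_symm]
      exact h3 _ hx _ hy (φ.arr g) w

/-- The map `b ↦ b ∘ φ` on sections. -/
def pullSection (φ : BorelHom Δ Γ) (H : HilbertBundle 𝕜 U) :
    ArrowSection Γ H →ₗ[𝕜] ArrowSection Δ (H.pullback φ.unit φ.measurable_unit) where
  toFun b x g := b (φ.unit x) (φ.fib x g)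
  map_add' _ _ := rfl
  map_smul' _ _ := rfl

theorem pullSection_isBorel (φ : BorelHom Δ Γ) {H : HilbertBundle 𝕜 U} {b : ArrowSection Γ H}
    (hb : b.IsBorel) : (φ.pullSection H b).IsBorel := by
  refine H.measurable_pullback_pt φ.unit φ.measurable_unit Δ.r Δ.measurable_r _ ?_
  have key : ∀ (g : G) (x : U) (h : Γ.r g = x),
      H.pt x (b x ⟨g, h⟩) = H.pt (Γ.r g) (b (Γ.r g) ⟨g, rfl⟩) := by
    rintro g _ rfl
    rfl
  refine Eq.mp (congrArg Measurable (funext fun g => ?_))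
    (Measurable.comp hb φ.measurable_toFun)
  exact (key (φ.toFun g) _ (φ.map_r g)).symm

theorem pullSection_isAECocycle (φ : BorelHom Δ Γ) {lam' : Δ.HaarSystem} {lam : Γ.HaarSystem}
    {μ' : Measure U'} {μ : Measure U} (hφ : Measure.QuasiMeasurePreserving φ.unit μ' μ)
    (hlam : φ.PreservesHaar lam' lam) {H : HilbertBundle 𝕜 U} {L : GroupoidRep Γ μ H}
    {b : ArrowSection Γ H} (hb : IsAECocycle lam μ L b) :
    IsAECocycle lam' μ' (φ.pullRep hφ L) (φ.pullSection H b) := by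
  have key : ∀ (x y y' : U) (h : y = y') (g : Γ.Arr x y) (g' : Γ.Arr x y') (k : Fib Γ.r x),
      g.1 = g'.1 →
      (b y (Γ.comp (Γ.symm g) k.arr).fib = b y (Γ.symm g).fib + L.op y x (Γ.symm g) (b x k)) →
      (b y' (Γ.comp (Γ.symm g') k.arr).fib =
        b y' (Γ.symm g').fib + L.op y' x (Γ.symm g') (b x k)) := by
    rintro x y _ rfl g g' k hg h
    obtain rfl : g = g' := Subtype.ext hg
    exact h
  filter_upwards [hφ.ae hb] with x hx
  filter_upwards [φ.ae_pull hlam x hx] with g₂ h₂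
  filter_upwards [φ.ae_pull hlam x h₂] with g₁ h₁
  have h := key _ _ (φ.unit (Δ.s g₁.1)) (φ.map_s g₁.1) _ (φ.arr g₁.arr) _ rfl h₁
  have e1 : (Γ.comp (Γ.symm (φ.arr g₁.arr)) (φ.fib x g₂).arr).fib =
      φ.fib _ (Δ.comp (Δ.symm g₁.arr) g₂.arr).fib := by
    refine Subtype.ext ?_
    refine Eq.trans ?_ (φ.map_mul _ _ _).symm
    exact Γ.mul_congr (φ.map_inv _).symm rfl _ _
  have e2 : (Γ.symm (φ.arr g₁.arr)).fib = φ.fib _ (Δ.symm g₁.arr).fib :=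
    Subtype.ext (φ.map_inv _).symm
  rw [e1, e2, ← φ.arr_symm] at h
  exact h

/-- The map `b ↦ b ∘ φ` on cocycles. -/
def pullCocycle (φ : BorelHom Δ Γ) {lam' : Δ.HaarSystem} {lam : Γ.HaarSystem}
    {μ' : Measure U'} {μ : Measure U} (hφ : Measure.QuasiMeasurePreserving φ.unit μ' μ)
    (hlam : φ.PreservesHaar lam' lam) {H : HilbertBundle 𝕜 U} (L : GroupoidRep Γ μ H) :
    cocycles lam μ L →ₗ[𝕜] cocycles lam' μ' (φ.pullRep hφ L) :=
  (φ.pullSection H).restrict fun _ hb =>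
    ⟨φ.pullSection_isBorel hb.1, φ.pullSection_isAECocycle hφ hlam hb.2⟩

theorem pullCocycle_null (φ : BorelHom Δ Γ) {lam' : Δ.HaarSystem} {lam : Γ.HaarSystem}
    {μ' : Measure U'} {μ : Measure U} (hφ : Measure.QuasiMeasurePreserving φ.unit μ' μ)
    (hlam : φ.PreservesHaar lam' lam) {H : HilbertBundle 𝕜 U} (L : GroupoidRep Γ μ H) :
    nullCocycles lam μ L ≤
      (nullCocycles lam' μ' (φ.pullRep hφ L)).comap (φ.pullCocycle hφ hlam L) := by
  intro b hb
  change ArrowSection.AEEq lam' μ' _ _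
  filter_upwards [hφ.ae hb] with x hx
  filter_upwards [φ.ae_pull hlam x hx] with g hg
  exact hg

theorem pullCocycle_coboundaries (φ : BorelHom Δ Γ) {lam' : Δ.HaarSystem} {lam : Γ.HaarSystem}
    {μ' : Measure U'} {μ : Measure U} (hφ : Measure.QuasiMeasurePreserving φ.unit μ' μ)
    (hlam : φ.PreservesHaar lam' lam) {H : HilbertBundle 𝕜 U} (L : GroupoidRep Γ μ H) :
    coboundaries lam μ L ≤
      (coboundaries lam' μ' (φ.pullRep hφ L)).comap (φ.pullCocycle hφ hlam L) := by
  rintro b ⟨ξ, hξ, hb⟩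
  refine ⟨fun x => ξ (φ.unit x), ?_, ?_⟩
  · exact H.measurable_pullback_pt φ.unit φ.measurable_unit id measurable_id _
      (Measurable.comp hξ φ.measurable_unit)
  · have key : ∀ (x y y' : U) (_ : y = y') (g : Γ.Arr x y) (g' : Γ.Arr x y'), g.1 = g'.1 →
        L.op x y g (ξ y) = L.op x y' g' (ξ y') := by
      rintro x y _ rfl g g' hg
      obtain rfl : g = g' := Subtype.ext hg
      rfl
    filter_upwards [hφ.ae hb] with x hx
    filter_upwards [φ.ae_pull hlam x hx] with g hg
    refine Eq.trans hg ?_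
    have := key _ _ (φ.unit (Δ.s g.1)) (φ.map_s g.1) (φ.fib x g).arr (φ.arr g.arr) rfl
    exact congrArg (fun t => ξ (φ.unit x) - t) this

/-- The map `φ^* : Z¹(Γ, L) → Z¹(Δ, L ∘ φ)` induced by `b ↦ b ∘ φ`. -/
def pullZ1 (φ : BorelHom Δ Γ) {lam' : Δ.HaarSystem} {lam : Γ.HaarSystem}
    {μ' : Measure U'} {μ : Measure U} (hφ : Measure.QuasiMeasurePreserving φ.unit μ' μ)
    (hlam : φ.PreservesHaar lam' lam) {H : HilbertBundle 𝕜 U} (L : GroupoidRep Γ μ H) :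
    Z1 lam μ L →ₗ[𝕜] Z1 lam' μ' (φ.pullRep hφ L) :=
  Submodule.mapQ _ _ (φ.pullCocycle hφ hlam L) (φ.pullCocycle_null hφ hlam L)

theorem pullZ1_B1 (φ : BorelHom Δ Γ) {lam' : Δ.HaarSystem} {lam : Γ.HaarSystem}
    {μ' : Measure U'} {μ : Measure U} (hφ : Measure.QuasiMeasurePreserving φ.unit μ' μ)
    (hlam : φ.PreservesHaar lam' lam) {H : HilbertBundle 𝕜 U} (L : GroupoidRep Γ μ H) :
    B1 lam μ L ≤ (B1 lam' μ' (φ.pullRep hφ L)).comap (φ.pullZ1 hφ hlam L) := by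
  rintro _ ⟨b, hb, rfl⟩
  exact ⟨φ.pullCocycle hφ hlam L b, φ.pullCocycle_coboundaries hφ hlam L hb, rfl⟩

/-- The map `φ^* : H¹(Γ, L) → H¹(Δ, L ∘ φ)` induced by `b ↦ b ∘ φ`. -/
def pullH1 (φ : BorelHom Δ Γ) {lam' : Δ.HaarSystem} {lam : Γ.HaarSystem}
    {μ' : Measure U'} {μ : Measure U} (hφ : Measure.QuasiMeasurePreserving φ.unit μ' μ)
    (hlam : φ.PreservesHaar lam' lam) {H : HilbertBundle 𝕜 U} (L : GroupoidRep Γ μ H) :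
    H1 lam μ L →ₗ[𝕜] H1 lam' μ' (φ.pullRep hφ L) :=
  Submodule.mapQ _ _ (φ.pullZ1 hφ hlam L) (φ.pullZ1_B1 hφ hlam L)

end BorelHom

/-! ### Pairs of measured spaces -/

/-- An equivariant Borel map `p : Y → X` between two `Γ`-spaces. -/
structure EquivariantMap {U : Type*} {G : Type*} {X : Type*} {Y : Type*} [MeasurableSpace U]
    [MeasurableSpace G] [MeasurableSpace X] [MeasurableSpace Y] {Γ : BorelGroupoid U G}
    (F : GSpace Γ Y) (E : GSpace Γ X) where
  p : Y → X
  measurable_p : Measurable p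
  anchor_p : ∀ y, E.anchor (p y) = F.anchor y
  p_act : ∀ g y e, p (F.act g y e) = E.act g (p y) (e.trans (anchor_p y).symm)

namespace EquivariantMap

variable {𝕜 : Type*} [RCLike 𝕜] {U : Type*} {G : Type*} {X : Type*} {Y : Type*}
  [MeasurableSpace U] [MeasurableSpace G] [MeasurableSpace X] [MeasurableSpace Y]
  {Γ : BorelGroupoid U G} {F : GSpace Γ Y} {E : GSpace Γ X}

/-- The homomorphism `(y, g) ↦ (p y, g)` from `Y ⋊ Γ` to `X ⋊ Γ`. -/
def hom (π : EquivariantMap F E) : BorelHom F.semidirect E.semidirect where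
  unit := π.p
  toFun a := ⟨(π.p a.1.1, a.1.2), (π.anchor_p _).trans a.2⟩
  measurable_unit := π.measurable_p
  measurable_toFun := ((π.measurable_p.comp measurable_subtype_coe.fst).prodMk
    measurable_subtype_coe.snd).subtype_mk
  map_r _ := rfl
  map_s _ := (π.p_act _ _ _).symm
  map_one y := Subtype.ext (Prod.ext rfl (congrArg Γ.one (π.anchor_p y).symm))
  map_inv _ := Subtype.ext (Prod.ext (π.p_act _ _ _) rfl)
  map_mul _ _ _ := rfl

theorem hom_preservesHaar [StandardBorelSpace U] (π : EquivariantMap F E) (lam : Γ.HaarSystem) :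
    π.hom.PreservesHaar (F.semidirectHaar lam) (E.semidirectHaar lam) := by
  intro y
  change ((lam.meas (F.anchor y)).map (F.incl y)).map (π.hom.fib y) =
    (lam.meas (E.anchor (π.p y))).map (E.incl (π.p y))
  rw [Measure.map_map (π.hom.measurable_fib y) (F.measurable_incl y)]
  have key : ∀ (z : U) (h : E.anchor (π.p y) = z), (lam.meas z).map
      (fun g : Fib Γ.r z => (⟨⟨(π.p y, g.1), h.trans g.2.symm⟩, rfl⟩ :
        Fib E.semidirect.r (π.p y))) =
      (lam.meas (E.anchor (π.p y))).map (E.incl (π.p y)) := by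
    rintro z rfl
    rfl
  exact key _ (π.anchor_p y)

/-- `((Y, ν), (X, μ), p)` is a pair of measured `Γ`-spaces: `ν` and `μ` are quasi-invariant, and
`μ` is equivalent to a pseudo-image of `ν`, that is, to the image of a finite measure equivalent
to `ν`. -/
structure IsMeasuredPair [StandardBorelSpace U] (π : EquivariantMap F E) (lam : Γ.HaarSystem)
    (ν : Measure Y) (μ : Measure X) : Prop where
  quasiInvariant_left : F.semidirect.QuasiInvariant (F.semidirectHaar lam) ν
  quasiInvariant_right : E.semidirect.QuasiInvariant (E.semidirectHaar lam) μ
  pseudoImage : ∃ ν' : Measure Y, IsFiniteMeasure ν' ∧ ν' ≪ ν ∧ ν ≪ ν' ∧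
    ν'.map π.p ≪ μ ∧ μ ≪ ν'.map π.p

theorem IsMeasuredPair.quasiMeasurePreserving [StandardBorelSpace U] {π : EquivariantMap F E}
    {lam : Γ.HaarSystem} {ν : Measure Y} {μ : Measure X} (h : π.IsMeasuredPair lam ν μ) :
    Measure.QuasiMeasurePreserving π.hom.unit ν μ := by
  obtain ⟨ν', -, -, h1, h2, -⟩ := h.pseudoImage
  exact ⟨π.measurable_p, (h1.map π.measurable_p).trans h2⟩

/-- The pair is ergodic: both `Γ`-spaces are. -/
def IsErgodicPair (_π : EquivariantMap F E) (ν : Measure Y) (μ : Measure X) : Prop :=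
  F.semidirect.IsErgodic ν ∧ E.semidirect.IsErgodic μ

/-- The translation `z ↦ g z` from the fibre of `p` at `x` to the fibre at `g x`. -/
def fibTranslate (π : EquivariantMap F E) (g : G) (x : X) (e : Γ.s g = E.anchor x)
    (z : Fib π.p x) : Fib π.p (E.act g x e) :=
  ⟨F.act g z.1 (e.trans ((congrArg E.anchor z.2.symm).trans (π.anchor_p _))),
    (π.p_act _ _ _).trans (E.act_congr rfl z.2 _ _)⟩

/-- The pair is measure preserving: `ν` disintegrates along `p` as `ν = ∫ ρ^x dμ(x)`, for an
invariant Borel system `ρ` of probability measures. -/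
def IsMeasurePreservingPair (π : EquivariantMap F E) (ν : Measure Y) (μ : Measure X) : Prop :=
  ∃ ρ : BorelSystem π.p, (∀ x, IsProbabilityMeasure (ρ.meas x)) ∧
    (∀ (g : G) (x : X) (e : Γ.s g = E.anchor x),
      (ρ.meas x).map (π.fibTranslate g x e) = ρ.meas (E.act g x e)) ∧
    ν = ρ.integrate μ

/-- The representation `L ∘ φ` of `Y ⋊ Γ`, where `φ (y, g) = (p y, g)`. -/
def rep [StandardBorelSpace U] [StandardBorelSpace X] [StandardBorelSpace Y]
    (π : EquivariantMap F E) {lam : Γ.HaarSystem} {ν : Measure Y} {μ : Measure X}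
    (h : π.IsMeasuredPair lam ν μ) {H : HilbertBundle 𝕜 X} (L : GroupoidRep E.semidirect μ H) :
    GroupoidRep F.semidirect ν (H.pullback π.hom.unit π.hom.measurable_unit) :=
  π.hom.pullRep h.quasiMeasurePreserving L

/-- The map `φ^* : H¹(X ⋊ Γ, L) → H¹(Y ⋊ Γ, L ∘ φ)`, where `φ (y, g) = (p y, g)`. -/
def cohomologyMap [StandardBorelSpace U] [StandardBorelSpace X] [StandardBorelSpace Y]
    (π : EquivariantMap F E) {lam : Γ.HaarSystem} {ν : Measure Y} {μ : Measure X}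
    (h : π.IsMeasuredPair lam ν μ) {H : HilbertBundle 𝕜 X} (L : GroupoidRep E.semidirect μ H) :
    H1 (E.semidirectHaar lam) μ L →ₗ[𝕜] H1 (F.semidirectHaar lam) ν (π.rep h L) :=
  π.hom.pullH1 h.quasiMeasurePreserving (π.hom_preservesHaar lam) L

end EquivariantMap

end MeasGrpd

end

open MeasGrpd

/-! Suppose that `b ∘ φ` is the coboundary of a Borel section `η` of the pull-back bundle. On the
fibre of `p` over `x`, `η` is a random vector in `H x` with respect to the probability measure
`ρ^x`. For almost every arrow `γ` from `x'` to `x`, the coboundary identity says that `η (γ z) = b γ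
+ L γ (η z)` for `ρ^{x'}`-almost every `z`. Since `γ` carries `ρ^{x'}` to `ρ^x`, the two random
vectors correspond under the affine isometry `v ↦ b γ + L γ v`. Any way of assigning to a random
vector a point of the Hilbert space that commutes with affine isometries therefore gives a section
`ξ` with `ξ x = b γ + L γ (ξ x')`, so that `b` is the coboundary of `ξ`.

The mean would be such an assignment if `η` were integrable on the fibres, which is not given. It is
replaced by a truncated mean. The `R`-core of a random vector `f` consists of the sample points
around whose value the ball of radius `R` has mass more than `1/2`. Two such balls meet, so `f` is
bounded on the core and can be averaged there, as soon as the core has positive mass. Taking the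
least natural number `R` for which this happens makes the choice canonical. Only distances and
masses enter, hence the equivariance `center_map`.

Two tasks remain. `fibreCenter_isBorelSection` shows that the centres form a Borel section: the
cores in the fibres are the slices of one Borel subset of `Y`, and the radius is a Borel function of
`x`. `aeEq_coboundary_fibreCenter` turns the identity for almost every arrow of `Y ⋊ Γ` into one for
almost every arrow of `X ⋊ Γ` and almost every point of the fibre, by Fubini. It uses
quasi-invariance to keep the sources of arrows in the conull set on which `L` is isometric. -/

noncomputable section

namespace MeasGrpd

/-! ### A centre for random vectors without moment assumptions -/

section Center

variable {Ω : Type*} [MeasurableSpace Ω] {V : Type*} [NormedAddCommGroup V]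

/-- The points `ω` such that more than half of the mass of `f` is at distance less than `R` from
`f ω`. -/
def coreSet (P : Measure Ω) (f : Ω → V) (R : ℕ) : Set Ω :=
  {ω | 1 / 2 < P {ω' | ‖f ω - f ω'‖ < R}}

theorem measurableSet_norm_sub_lt {f : Ω → V} (hf : StronglyMeasurable f) (R : ℕ) :
    MeasurableSet {q : Ω × Ω | ‖f q.1 - f q.2‖ < R} :=
  measurableSet_lt ((hf.comp_measurable measurable_fst).sub
    (hf.comp_measurable measurable_snd)).norm.measurable measurable_const

theorem measurableSet_coreSet (P : Measure Ω) [SFinite P] {f : Ω → V} (hf : StronglyMeasurable f)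
    (R : ℕ) : MeasurableSet (coreSet P f R) :=
  measurableSet_lt measurable_const
    (measurable_measure_prodMk_left (measurableSet_norm_sub_lt hf R))

/-- The balls of integer radius around `f ω` exhaust the space, so one of them has mass more than
`1/2`. Hence the cores cover `Ω`, and countably many null sets cannot do so. -/
theorem exists_measure_coreSet_ne_zero (P : Measure Ω) [IsProbabilityMeasure P] (f : Ω → V) :
    ∃ R, P (coreSet P f R) ≠ 0 := by
  by_contra! h
  have huniv : (⋃ R, coreSet P f R) = Set.univ := by
    refine Set.eq_univ_of_forall fun ω => Set.mem_iUnion.2 ?_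
    have hmono : Monotone fun R : ℕ => {ω' | ‖f ω - f ω'‖ < R} := fun R R' hR ω' h =>
      lt_of_lt_of_le (show ‖f ω - f ω'‖ < R from h) (by exact_mod_cast hR)
    have hU : (⋃ R : ℕ, {ω' | ‖f ω - f ω'‖ < R}) = Set.univ :=
      Set.eq_univ_of_forall fun ω' => Set.mem_iUnion.2 (exists_nat_gt ‖f ω - f ω'‖)
    have hlim := tendsto_measure_iUnion_atTop (μ := P) hmono
    rw [hU, measure_univ] at hlim
    exact (hlim.eventually (lt_mem_nhds (by simp : (1 / 2 : ℝ≥0∞) < 1))).exists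
  have h0 := measure_iUnion_null h
  rw [huniv, measure_univ] at h0
  exact one_ne_zero h0

/-- Two balls of mass more than `1 / 2` intersect. -/
theorem norm_sub_le_of_mem_coreSet (P : Measure Ω) [IsProbabilityMeasure P] {f : Ω → V}
    (hf : StronglyMeasurable f) {R : ℕ} {ω₁ ω₂ : Ω} (h₁ : ω₁ ∈ coreSet P f R)
    (h₂ : ω₂ ∈ coreSet P f R) : ‖f ω₁ - f ω₂‖ ≤ 2 * R := by
  have hne : ({ω' | ‖f ω₁ - f ω'‖ < R} ∩ {ω' | ‖f ω₂ - f ω'‖ < R}).Nonempty := by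
    refine nonempty_inter_of_measure_lt_add (u := Set.univ) P
      (measurable_prodMk_left (measurableSet_norm_sub_lt hf R))
      (Set.subset_univ _) (Set.subset_univ _) ?_
    -- The strict inequality in the definition of the core makes the two masses add up to more than
    -- the total mass `1`.
    rw [measure_univ, ← ENNReal.add_halves 1]
    exact ENNReal.add_lt_add h₁ h₂
  obtain ⟨ω, hω₁, hω₂⟩ := hne
  have hω₁ : ‖f ω₁ - f ω‖ < R := hω₁
  have hω₂ : ‖f ω₂ - f ω‖ < R := hω₂
  have := norm_sub_le_norm_sub_add_norm_sub (f ω₁) (f ω) (f ω₂)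
  rw [norm_sub_rev (f ω)] at this
  linarith

/-- On the core all values of `f` lie within `2 * R` of any one of them, so `f` is bounded there
without any moment assumption. -/
theorem integrableOn_coreSet (P : Measure Ω) [IsProbabilityMeasure P] {f : Ω → V}
    (hf : StronglyMeasurable f) (R : ℕ) : IntegrableOn f (coreSet P f R) P := by
  rcases (coreSet P f R).eq_empty_or_nonempty with h | ⟨ω₀, h₀⟩
  · rw [h]
    exact integrableOn_empty
  · refine Measure.integrableOn_of_bounded (M := ‖f ω₀‖ + 2 * R) (measure_ne_top _ _)
      hf.aestronglyMeasurable ?_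
    refine (ae_restrict_mem (measurableSet_coreSet P hf R)).mono fun ω hω => ?_
    have h1 := norm_sub_le_of_mem_coreSet P hf hω h₀
    have h2 := norm_le_norm_add_norm_sub' (f ω) (f ω₀)
    linarith

open Classical in
/-- The least radius for which the core has positive mass. -/
def coreRadius (P : Measure Ω) [IsProbabilityMeasure P] (f : Ω → V) : ℕ :=
  Nat.find (exists_measure_coreSet_ne_zero P f)

theorem measure_coreSet_coreRadius_ne_zero (P : Measure Ω) [IsProbabilityMeasure P] (f : Ω → V) :
    P (coreSet P f (coreRadius P f)) ≠ 0 := by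
  classical
  exact Nat.find_spec (exists_measure_coreSet_ne_zero P f)

variable {𝕜 : Type*} [RCLike 𝕜] [NormedSpace 𝕜 V] {Ω' : Type*} [MeasurableSpace Ω']
  {V' : Type*} [NormedAddCommGroup V'] [NormedSpace 𝕜 V']

/-- The translation `β` cancels in differences and `A` preserves norms, so corresponding balls have
the same mass. The cores agree only up to a null set because the relation between `f` and `f'` holds
only almost everywhere. -/
theorem preimage_coreSet {P : Measure Ω} {P' : Measure Ω'} {T : Ω' → Ω}
    (hT : MeasurePreserving T P' P) {f : Ω → V} {f' : Ω' → V'} (hf : StronglyMeasurable f)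
    (A : V' →L[𝕜] V) (hA : ∀ v, ‖A v‖ = ‖v‖) (β : V) (h : ∀ᵐ ω ∂P', f (T ω) = β + A (f' ω))
    (R : ℕ) : T ⁻¹' coreSet P f R =ᵐ[P'] coreSet P' f' R := by
  filter_upwards [h] with ω hω
  have key : P {ω' | ‖f (T ω) - f ω'‖ < R} = P' {ω' | ‖f' ω - f' ω'‖ < R} := by
    have hm : MeasurableSet {ω' | ‖f (T ω) - f ω'‖ < R} :=
      measurable_prodMk_left (measurableSet_norm_sub_lt hf R)
    rw [← hT.measure_preimage hm.nullMeasurableSet]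
    refine measure_congr ?_
    filter_upwards [h] with ω' hω'
    change (‖f (T ω) - f (T ω')‖ < R) = (‖f' ω - f' ω'‖ < R)
    rw [hω, hω', add_sub_add_left_eq_sub, ← map_sub, hA]
  change (1 / 2 < P {ω' | ‖f (T ω) - f ω'‖ < R}) = (1 / 2 < P' {ω' | ‖f' ω - f' ω'‖ < R})
  rw [key]

variable [NormedSpace ℝ V] [NormedSpace ℝ V']

variable (𝕜) in
/-- The mean of `f` over its core. -/
def center (P : Measure Ω) [IsProbabilityMeasure P] (f : Ω → V) : V :=
  ((P.real (coreSet P f (coreRadius P f)) : ℝ) : 𝕜)⁻¹ • ∫ ω in coreSet P f (coreRadius P f), f ω ∂P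

/-- The centre is equivariant under affine isometries. -/
theorem center_map [CompleteSpace V] [CompleteSpace V'] {P : Measure Ω} [IsProbabilityMeasure P]
    {P' : Measure Ω'} [IsProbabilityMeasure P'] {T : Ω' → Ω}
    (hT : MeasurePreserving T P' P) {f : Ω → V} {f' : Ω' → V'} (hf : StronglyMeasurable f)
    (hf' : StronglyMeasurable f') (A : V' →L[𝕜] V) (hA : ∀ v, ‖A v‖ = ‖v‖) (β : V)
    (h : ∀ᵐ ω ∂P', f (T ω) = β + A (f' ω)) :
    center 𝕜 P f = β + A (center 𝕜 P' f') := by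
  have hpre := preimage_coreSet hT hf A hA β h
  have hmeas : ∀ R, P (coreSet P f R) = P' (coreSet P' f' R) := fun R => by
    rw [← hT.measure_preimage (measurableSet_coreSet P hf R).nullMeasurableSet,
      measure_congr (hpre R)]
  -- The least radius depends only on the masses of the cores, which agree for every `R`.
  have hR : coreRadius P f = coreRadius P' f' := by
    classical
    unfold coreRadius
    congr 1
    funext R
    rw [hmeas R]
  have hne := measure_coreSet_coreRadius_ne_zero P' f'
  unfold center
  rw [hR]
  set R := coreRadius P' f'
  have hreal : P.real (coreSet P f R) = P'.real (coreSet P' f' R) := by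
    rw [measureReal_def, hmeas R, measureReal_def]
  have hne' : ((P'.real (coreSet P' f' R) : ℝ) : 𝕜) ≠ 0 := by
    rw [Ne, RCLike.ofReal_eq_zero, measureReal_def]
    exact (ENNReal.toReal_pos hne (measure_ne_top _ _)).ne'
  have hint : ∫ ω in coreSet P f R, f ω ∂P =
      ((P'.real (coreSet P' f' R) : ℝ) : 𝕜) • β + A (∫ ω in coreSet P' f' R, f' ω ∂P') := by
    have hI := integrableOn_coreSet P' hf' R
    calc ∫ ω in coreSet P f R, f ω ∂P
        = ∫ ω in coreSet P f R, f ω ∂(P'.map T) := by rw [hT.map_eq]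
      _ = ∫ ω in T ⁻¹' coreSet P f R, f (T ω) ∂P' :=
          setIntegral_map (measurableSet_coreSet P hf R) hf.aestronglyMeasurable hT.aemeasurable
      _ = ∫ ω in coreSet P' f' R, f (T ω) ∂P' := setIntegral_congr_set (hpre R)
      _ = ∫ ω in coreSet P' f' R, (β + A (f' ω)) ∂P' :=
          integral_congr_ae (ae_restrict_of_ae h)
      _ = ∫ ω in coreSet P' f' R, β ∂P' + ∫ ω in coreSet P' f' R, A (f' ω) ∂P' :=
          integral_add (integrable_const _) (A.integrable_comp hI)
      _ = _ := by
        -- The integral of the constant `β` is wanted as a `𝕜`-multiple of `β`, and the real and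
        -- `𝕜`-scalar actions on `V` are not assumed compatible. The scalar is therefore computed by
        -- integrating `1` in `𝕜`.
        have hc := integral_smul_const (μ := P'.restrict (coreSet P' f' R)) (fun _ => (1 : 𝕜)) β
        have h1 : ∫ _ in coreSet P' f' R, (1 : 𝕜) ∂P' = ((P'.real (coreSet P' f' R) : ℝ) : 𝕜) := by
          rw [setIntegral_const, RCLike.real_smul_eq_coe_mul, mul_one]
        simp only [one_smul, h1] at hc
        rw [A.integral_comp_comm hI, hc]
  rw [hint, hreal, smul_add, inv_smul_smul₀ hne', map_smul]

end Center

/-! ### Measurability in Hilbert bundles -/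

universe u

namespace HilbertBundle

variable {𝕜 : Type*} [RCLike 𝕜] {X : Type u} [MeasurableSpace X]

instance (H : HilbertBundle 𝕜 X) (x : X) : NormedSpace ℝ (H.fibre x) :=
  NormedSpace.restrictScalars ℝ 𝕜 (H.fibre x)

/-- A vector orthogonal to the fundamental sequence has the same coordinates as `0`, hence vanishes
by `fund_separates`. Separability of the fibres follows. -/
theorem closure_span_fund (H : HilbertBundle 𝕜 X) (x : X) :
    (Submodule.span 𝕜 (Set.range fun n => H.fund n x)).topologicalClosure = ⊤ := by
  rw [Submodule.topologicalClosure_eq_top_iff, Submodule.eq_bot_iff]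
  intro v hv
  refine H.fund_separates x v 0 fun n => ?_
  rw [inner_zero_right]
  exact (Submodule.mem_orthogonal _ v).1 hv _ (Submodule.subset_span ⟨n, rfl⟩)

instance (H : HilbertBundle 𝕜 X) (x : X) : SecondCountableTopology (H.fibre x) := by
  have h : TopologicalSpace.IsSeparable
      (closure (Submodule.span 𝕜 (Set.range fun n => H.fund n x) : Set (H.fibre x))) :=
    ((Set.countable_range _).isSeparable.span).closure
  rw [← Submodule.topologicalClosure_coe, closure_span_fund, Submodule.top_coe,
    TopologicalSpace.isSeparable_univ_iff] at h
  exact UniformSpace.secondCountable_of_separable _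

/-- A linear combination of the first `N` sections of the fundamental sequence. -/
def comb (H : HilbertBundle 𝕜 X) {N : ℕ} (c : Fin N → 𝕜) (x : X) : H.fibre x :=
  ∑ i : Fin N, c i • H.fund i x

theorem exists_comb_eq (H : HilbertBundle 𝕜 X) {x : X} {v : H.fibre x}
    (hv : v ∈ Submodule.span 𝕜 (Set.range fun n => H.fund n x)) :
    ∃ (N : ℕ) (c : Fin N → 𝕜), H.comb c x = v := by
  obtain ⟨c, rfl⟩ := Finsupp.mem_span_range_iff_exists_finsupp.1 hv
  obtain ⟨N, hN⟩ := c.support.exists_nat_subset_range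
  refine ⟨N, fun i => c i, ?_⟩
  rw [Finsupp.sum_of_support_subset c hN (fun i a => a • H.fund i x) (fun i _ => zero_smul _ _)]
  exact Fin.sum_univ_eq_sum_range (fun i => c i • H.fund i x) N

/-- Expresses the norm through countably many coordinate conditions, which makes it a Borel
function. The inequality extends from the dense coefficient vectors to all combinations, and then by
density to every test vector in the fibre; testing against `v` itself gives `‖v‖ ^ 2 ≤ r * ‖v‖`. -/
theorem norm_le_iff (H : HilbertBundle 𝕜 X) {x : X} (v : H.fibre x) (r : ℝ) (hr : 0 ≤ r) :
    ‖v‖ ≤ r ↔ ∀ N k : ℕ,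
      ‖inner 𝕜 (H.comb (TopologicalSpace.denseSeq (Fin N → 𝕜) k) x) v‖ ≤
        r * ‖H.comb (TopologicalSpace.denseSeq (Fin N → 𝕜) k) x‖ := by
  constructor
  · intro h N k
    refine (norm_inner_le_norm _ _).trans ?_
    rw [mul_comm]
    exact mul_le_mul_of_nonneg_right h (norm_nonneg _)
  · intro h
    have h1 : ∀ N (c : Fin N → 𝕜), ‖inner 𝕜 (H.comb c x) v‖ ≤ r * ‖H.comb c x‖ := by
      intro N c
      have hc : Continuous fun c : Fin N → 𝕜 => H.comb c x := by
        unfold comb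
        fun_prop
      exact (TopologicalSpace.denseRange_denseSeq (Fin N → 𝕜)).induction_on
        (p := fun c => ‖inner 𝕜 (H.comb c x) v‖ ≤ r * ‖H.comb c x‖) c
        (isClosed_le (hc.inner continuous_const).norm (continuous_const.mul hc.norm)) (h N)
    have h2 : closure (Submodule.span 𝕜 (Set.range fun n => H.fund n x) : Set (H.fibre x)) ⊆
        {u | ‖inner 𝕜 u v‖ ≤ r * ‖u‖} := by
      refine closure_minimal ?_ (isClosed_le (by fun_prop) (by fun_prop))
      intro u hu
      obtain ⟨N, c, rfl⟩ := H.exists_comb_eq hu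
      exact h1 N c
    rw [← Submodule.topologicalClosure_coe, closure_span_fund] at h2
    have h3 : ‖inner 𝕜 v v‖ ≤ r * ‖v‖ := h2 (Set.mem_univ v)
    rw [inner_self_eq_norm_sq_to_K, norm_pow, RCLike.norm_ofReal, abs_norm] at h3
    rcases (norm_nonneg v).eq_or_lt with h0 | h0
    · rw [← h0]
      exact hr
    · nlinarith

theorem measurable_norm_comb (H : HilbertBundle 𝕜 X) {N : ℕ} (c : Fin N → 𝕜) :
    Measurable fun x => ‖H.comb c x‖ := by
  simp_rw [norm_eq_sqrt_re_inner (𝕜 := 𝕜), comb, sum_inner, inner_sum, inner_smul_left,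
    inner_smul_right]
  refine (RCLike.continuous_re.measurable.comp ?_).sqrt
  exact Finset.measurable_sum _ fun i _ => Finset.measurable_sum _ fun j _ =>
    ((H.fund_gram i j).const_mul _).const_mul _

theorem measurable_norm (H : HilbertBundle 𝕜 X) : Measurable fun v : H.Total => ‖v.2‖ := by
  refine measurable_of_Iic fun r => ?_
  rcases lt_or_ge r 0 with hr | hr
  · convert MeasurableSet.empty
    ext v
    simpa using hr.trans_le (norm_nonneg v.2)
  · have : (fun v : H.Total => ‖v.2‖) ⁻¹' Set.Iic r = ⋂ N : ℕ, ⋂ k : ℕ,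
        {v : H.Total | ‖inner 𝕜 (H.comb (TopologicalSpace.denseSeq (Fin N → 𝕜) k) v.1) v.2‖ ≤
          r * ‖H.comb (TopologicalSpace.denseSeq (Fin N → 𝕜) k) v.1‖} := by
      ext v
      simp only [Set.mem_preimage, Set.mem_Iic, Set.mem_iInter, Set.mem_ofPred_eq]
      exact H.norm_le_iff v.2 r hr
    rw [this]
    refine MeasurableSet.iInter fun N => MeasurableSet.iInter fun k => measurableSet_le ?_ ?_
    · simp_rw [comb, sum_inner, inner_smul_left]
      have hfund : ∀ n, Measurable fun v : H.Total => inner 𝕜 (H.fund n v.1) v.2 := H.fund_inner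
      refine Measurable.norm (Finset.measurable_sum _ fun i _ => ?_)
      exact (hfund i).const_mul _
    · exact ((H.measurable_norm_comb _).comp H.measurable_proj).const_mul r

variable {Ω : Type*} [MeasurableSpace Ω]

/-- The coordinate map of a fibre is a continuous injection of a Polish space, hence a Borel
embedding by Lusin–Souslin. So weak measurability suffices. -/
theorem stronglyMeasurable_of_inner (H : HilbertBundle 𝕜 X) {x : X} {f : Ω → H.fibre x}
    (h : ∀ n, Measurable fun ω => inner 𝕜 (H.fund n x) (f ω)) : StronglyMeasurable f := by
  borelize (H.fibre x)
  have hemb : MeasurableEmbedding fun v : H.fibre x => fun n => inner 𝕜 (H.fund n x) v := by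
    refine Continuous.measurableEmbedding (by fun_prop) fun v w hvw => ?_
    exact H.fund_separates x v w fun n => congrFun hvw n
  exact (hemb.measurable_comp_iff.1 (measurable_pi_iff.2 h)).stronglyMeasurable

variable [StandardBorelSpace X]

theorem measurable_pt_add (H : HilbertBundle 𝕜 X) {x : Ω → X} {v w : ∀ ω, H.fibre (x ω)}
    (hv : Measurable fun ω => H.pt (x ω) (v ω)) (hw : Measurable fun ω => H.pt (x ω) (w ω)) :
    Measurable fun ω => H.pt (x ω) (v ω + w ω) := by
  rw [H.measurable_pt_iff] at hv hw ⊢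
  simp_rw [inner_add_right]
  exact ⟨hv.1, fun n => (hv.2 n).add (hw.2 n)⟩

theorem measurable_pt_smul (H : HilbertBundle 𝕜 X) {x : Ω → X} {v : ∀ ω, H.fibre (x ω)}
    (hv : Measurable fun ω => H.pt (x ω) (v ω)) (c : 𝕜) :
    Measurable fun ω => H.pt (x ω) (c • v ω) := by
  rw [H.measurable_pt_iff] at hv ⊢
  simp_rw [inner_smul_right]
  exact ⟨hv.1, fun n => (hv.2 n).const_mul c⟩

theorem measurable_pt_sub (H : HilbertBundle 𝕜 X) {x : Ω → X} {v w : ∀ ω, H.fibre (x ω)}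
    (hv : Measurable fun ω => H.pt (x ω) (v ω)) (hw : Measurable fun ω => H.pt (x ω) (w ω)) :
    Measurable fun ω => H.pt (x ω) (v ω - w ω) := by
  rw [H.measurable_pt_iff] at hv hw ⊢
  simp_rw [inner_sub_right]
  exact ⟨hv.1, fun n => (hv.2 n).sub (hw.2 n)⟩

/-- Polarization reduces inner products of arbitrary sections to norms. -/
theorem measurable_inner (H : HilbertBundle 𝕜 X) {x : Ω → X} {v w : ∀ ω, H.fibre (x ω)}
    (hv : Measurable fun ω => H.pt (x ω) (v ω)) (hw : Measurable fun ω => H.pt (x ω) (w ω)) :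
    Measurable fun ω => inner 𝕜 (v ω) (w ω) := by
  have hn : ∀ u : ∀ ω, H.fibre (x ω), Measurable (fun ω => H.pt (x ω) (u ω)) →
      Measurable fun ω => ((‖u ω‖ : ℝ) : 𝕜) := fun u hu =>
    RCLike.measurable_ofReal.comp (H.measurable_norm.comp hu)
  have hI := H.measurable_pt_smul hw RCLike.I
  simp_rw [inner_eq_sum_norm_sq_div_four]
  have h1 := hn _ (H.measurable_pt_add hv hw)
  have h2 := hn _ (H.measurable_pt_sub hv hw)
  have h3 := hn _ (H.measurable_pt_sub hv hI)
  have h4 := hn _ (H.measurable_pt_add hv hI)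
  fun_prop

end HilbertBundle

/-! ### Borel measurability of coboundaries and of equality sets -/

section Coboundary

variable {𝕜 : Type*} [RCLike 𝕜] {U G : Type*} [MeasurableSpace U] [StandardBorelSpace U]
  [MeasurableSpace G] {Γ : BorelGroupoid U G} {H : HilbertBundle 𝕜 U}

/-- A representation is Borel only through its matrix coefficients against the fundamental sequence.
Moving `L` to the other side shows that its adjoint sends the fundamental sections to Borel sections
over the source, which can then be paired with `ξ`. -/
theorem coboundary_isBorel {μ : Measure U} (L : GroupoidRep Γ μ H) {ξ : ∀ x, H.fibre x}
    (hξ : H.IsBorelSection ξ) : (coboundary L ξ).IsBorel := by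
  refine H.measurable_pt_sub (Measurable.comp hξ Γ.measurable_r) ?_
  refine (H.measurable_pt_iff _ _).2 ⟨Γ.measurable_r, fun n => ?_⟩
  have hadj : Measurable fun g : G => H.pt (Γ.s g)
      ((L.op (Γ.r g) (Γ.s g) ⟨g, rfl, rfl⟩).adjoint (H.fund n (Γ.r g))) := by
    refine (H.measurable_pt_iff _ _).2 ⟨Γ.measurable_s, fun m => ?_⟩
    simp_rw [ContinuousLinearMap.adjoint_inner_right]
    have := RCLike.continuous_conj.measurable.comp (L.borel n m)
    simpa only [Function.comp_def, inner_conj_symm] using this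
  have := H.measurable_inner hadj (Measurable.comp hξ Γ.measurable_s)
  simp only [ContinuousLinearMap.adjoint_inner_left] at this
  exact this

theorem ArrowSection.IsBorel.measurableSet_eq {b c : ArrowSection Γ H} (hb : b.IsBorel)
    (hc : c.IsBorel) : MeasurableSet {g : G | b (Γ.r g) ⟨g, rfl⟩ = c (Γ.r g) ⟨g, rfl⟩} := by
  have : {g : G | b (Γ.r g) ⟨g, rfl⟩ = c (Γ.r g) ⟨g, rfl⟩} = ⋂ n,
      {g | inner 𝕜 (H.fund n (Γ.r g)) (b (Γ.r g) ⟨g, rfl⟩) =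
        inner 𝕜 (H.fund n (Γ.r g)) (c (Γ.r g) ⟨g, rfl⟩)} := by
    ext g
    simp only [Set.mem_iInter, Set.mem_ofPred_eq]
    exact ⟨fun h n => by rw [h], fun h => H.fund_separates _ _ _ h⟩
  rw [this]
  exact MeasurableSet.iInter fun n => measurableSet_eq_fun
    (((H.measurable_pt_iff _ _).1 hb).2 n) (((H.measurable_pt_iff _ _).1 hc).2 n)

end Coboundary

/-- Allows a Borel, integer-valued radius depending on the point to be substituted into a sequence
of Borel functions. -/
theorem measurable_apply_nat {X E : Type*} [MeasurableSpace X] [MeasurableSpace E]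
    {K : ℕ → X → E} (hK : ∀ n, Measurable (K n)) {R : X → ℕ} (hR : Measurable R) :
    Measurable fun x => K (R x) x :=
  (measurable_from_prod_countable_right (f := Function.uncurry K) hK).comp
    (hR.prodMk measurable_id)

/-! ### Fibrewise centres of a section of a pull-back bundle -/

section FibreCenter

variable {𝕜 : Type*} [RCLike 𝕜] {X Y : Type*} [MeasurableSpace X] {H : HilbertBundle 𝕜 X}
  {p : Y → X}

/-- The restriction to the fibre `p⁻¹(x)` of a section of `p^* H`, as a map into `H x`. -/
def restrictFib (η : ∀ y, H.fibre (p y)) (x : X) (y : Fib p x) : H.fibre x := y.2 ▸ η y.1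

theorem inner_restrictFib (η : ∀ y, H.fibre (p y)) (x : X) (y : Fib p x) (n : ℕ) :
    inner 𝕜 (H.fund n x) (restrictFib η x y) = inner 𝕜 (H.fund n (p y.1)) (η y.1) := by
  obtain ⟨y, rfl⟩ := y
  rfl

variable [MeasurableSpace Y]

theorem BorelSystem.toKernel_apply {ρ : BorelSystem p} (x : X) :
    ρ.toKernel x = (ρ.meas x).map Subtype.val := rfl

variable [StandardBorelSpace X]

theorem stronglyMeasurable_restrictFib {η : ∀ y, H.fibre (p y)}
    (hη : Measurable fun y => H.pt (p y) (η y)) (x : X) : StronglyMeasurable (restrictFib η x) := by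
  refine H.stronglyMeasurable_of_inner fun n => ?_
  simp_rw [inner_restrictFib]
  exact (((H.measurable_pt_iff _ _).1 hη).2 n).comp measurable_subtype_coe

/-- The pairs of points in a common fibre at which the values of `η` are at distance less
than `R`. -/
def closePairs (η : ∀ y, H.fibre (p y)) (R : ℕ) : Set (Y × Y) :=
  {q | ∃ h : p q.2 = p q.1, ‖η q.1 - restrictFib η (p q.1) ⟨q.2, h⟩‖ < R}

/-- The two values can be subtracted only over the Borel set of pairs with the same image under `p`.
The norm of the difference is Borel there, and the set is then carried back to `Y × Y`. -/
theorem measurableSet_closePairs (hp : Measurable p) {η : ∀ y, H.fibre (p y)}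
    (hη : Measurable fun y => H.pt (p y) (η y)) (R : ℕ) : MeasurableSet (closePairs η R) := by
  have hZ : MeasurableSet {q : Y × Y | p q.2 = p q.1} :=
    measurableSet_eq_fun (hp.comp measurable_snd) (hp.comp measurable_fst)
  have h1 : Measurable fun q : {q : Y × Y | p q.2 = p q.1} => H.pt (p q.1.1) (η q.1.1) :=
    hη.comp measurable_subtype_coe.fst
  have h2 : Measurable fun q : {q : Y × Y | p q.2 = p q.1} =>
      H.pt (p q.1.1) (restrictFib η (p q.1.1) ⟨q.1.2, q.2⟩) := by
    refine (H.measurable_pt_iff _ _).2 ⟨hp.comp measurable_subtype_coe.fst, fun n => ?_⟩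
    simp_rw [inner_restrictFib]
    exact (((H.measurable_pt_iff _ _).1 hη).2 n).comp measurable_subtype_coe.snd
  have h3 := H.measurable_norm.comp (H.measurable_pt_sub h1 h2)
  convert hZ.subtype_image (measurableSet_lt h3 (measurable_const (a := (R : ℝ)))) using 1
  ext q
  constructor
  · rintro ⟨h, hq⟩
    exact ⟨⟨q, h⟩, hq, rfl⟩
  · rintro ⟨⟨q, h⟩, hq, rfl⟩
    exact ⟨h, hq⟩

/-- The union over all fibres of the cores of `η`. -/
def totalCore (ρ : BorelSystem p) (η : ∀ y, H.fibre (p y)) (R : ℕ) : Set Y :=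
  {y | 1 / 2 < ρ.toKernel (p y) (Prod.mk y ⁻¹' closePairs η R)}

variable (ρ : BorelSystem p)

/-- Makes the cores vary measurably with `x`: in every fibre the core is the trace of one subset of
`Y`, so its mass is a kernel evaluated on a fixed set. -/
theorem coreSet_restrictFib (hp : Measurable p) {η : ∀ y, H.fibre (p y)}
    (hη : Measurable fun y => H.pt (p y) (η y)) (x : X) (R : ℕ) :
    coreSet (ρ.meas x) (restrictFib η x) R = Subtype.val ⁻¹' totalCore ρ η R := by
  ext ⟨y, hy⟩
  subst hy
  change 1 / 2 < ρ.meas (p y)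
      {y' : Fib p (p y) | ‖restrictFib η (p y) ⟨y, rfl⟩ - restrictFib η (p y) y'‖ < R} ↔
    1 / 2 < ρ.toKernel (p y) (Prod.mk y ⁻¹' closePairs η R)
  rw [BorelSystem.toKernel_apply, Measure.map_apply measurable_subtype_coe
    (measurable_prodMk_left (measurableSet_closePairs hp hη R))]
  have : {y' : Fib p (p y) | ‖restrictFib η (p y) ⟨y, rfl⟩ - restrictFib η (p y) y'‖ < R} =
      Subtype.val ⁻¹' (Prod.mk y ⁻¹' closePairs η R) := by
    ext y'
    exact ⟨fun h => ⟨y'.2, h⟩, fun ⟨_, h⟩ => h⟩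
  rw [this]

variable [∀ x, IsProbabilityMeasure (ρ.meas x)]

instance : IsMarkovKernel ρ.toKernel :=
  ⟨fun _ => Measure.isProbabilityMeasure_map measurable_subtype_coe.aemeasurable⟩

theorem measurableSet_totalCore (hp : Measurable p) {η : ∀ y, H.fibre (p y)}
    (hη : Measurable fun y => H.pt (p y) (η y)) (R : ℕ) : MeasurableSet (totalCore ρ η R) :=
  measurableSet_lt measurable_const <| Kernel.measurable_kernel_prodMk_left
    (κ := ρ.toKernel.comap p hp) (measurableSet_closePairs hp hη R)

/-- The centre of the restriction of `η` to the fibre at `x`. -/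
def fibreCenter (η : ∀ y, H.fibre (p y)) (x : X) : H.fibre x :=
  center 𝕜 (ρ.meas x) (restrictFib η x)

/-- For fixed `R`, each coordinate of the mean over the core is a kernel integral, hence Borel in
`x`. The least radius is Borel too, and it is substituted for `R`. -/
theorem fibreCenter_isBorelSection (hp : Measurable p) {η : ∀ y, H.fibre (p y)}
    (hη : Measurable fun y => H.pt (p y) (η y)) : H.IsBorelSection (fibreCenter ρ η) := by
  refine (H.measurable_pt_iff _ _).2 ⟨measurable_id, fun n => ?_⟩
  have hcore := measurableSet_totalCore ρ hp hη
  have hmeas : ∀ x R, ρ.meas x (coreSet (ρ.meas x) (restrictFib η x) R) =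
      ρ.toKernel x (totalCore ρ η R) := fun x R => by
    rw [coreSet_restrictFib ρ hp hη, BorelSystem.toKernel_apply,
      Measure.map_apply measurable_subtype_coe (hcore R)]
  have hcoef : Measurable fun y => inner 𝕜 (H.fund n (p y)) (η y) :=
    ((H.measurable_pt_iff _ _).1 hη).2 n
  -- Where the core is null, the inverse takes the value `0`; this is harmless, since the radius
  -- substituted later always gives a core of positive mass.
  let K : ℕ → X → 𝕜 := fun R x => (((ρ.toKernel x).real (totalCore ρ η R) : ℝ) : 𝕜)⁻¹ *
    ∫ y, (totalCore ρ η R).indicator (fun y => inner 𝕜 (H.fund n (p y)) (η y)) y ∂(ρ.toKernel x)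
  have hK : ∀ R, Measurable (K R) := fun R =>
    ((RCLike.measurable_ofReal.comp
      (ρ.toKernel.measurable_coe (hcore R)).ennreal_toReal).inv).mul
      (hcoef.indicator (hcore R)).stronglyMeasurable.integral_kernel.measurable
  have hrad : Measurable fun x => coreRadius (ρ.meas x) (restrictFib η x) := by
    classical
    refine measurable_find _ fun R => ?_
    simp_rw [hmeas]
    exact (measurableSet_eq_fun (ρ.toKernel.measurable_coe (hcore R)) measurable_const).compl
  have heq : ∀ x, inner 𝕜 (H.fund n x) (fibreCenter ρ η x) =
      K (coreRadius (ρ.meas x) (restrictFib η x)) x := by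
    intro x
    set R := coreRadius (ρ.meas x) (restrictFib η x) with hR
    have hint : inner 𝕜 (H.fund n x)
        (∫ y in coreSet (ρ.meas x) (restrictFib η x) R, restrictFib η x y ∂(ρ.meas x)) =
        ∫ y, (totalCore ρ η R).indicator (fun y => inner 𝕜 (H.fund n (p y)) (η y)) y
          ∂(ρ.toKernel x) := by
      rw [← integral_inner (integrableOn_coreSet _ (stronglyMeasurable_restrictFib hη x) R),
        integral_indicator (hcore R), BorelSystem.toKernel_apply,
        setIntegral_map (hcore R) hcoef.aestronglyMeasurable measurable_subtype_coe.aemeasurable,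
        coreSet_restrictFib ρ hp hη]
      simp_rw [inner_restrictFib]
    change inner 𝕜 (H.fund n x) (center 𝕜 (ρ.meas x) (restrictFib η x)) = _
    rw [center, ← hR, inner_smul_right, hint, measureReal_def, hmeas]
    rfl
  have hcomp := measurable_apply_nat hK hrad
  rw [← funext heq] at hcomp
  exact hcomp

end FibreCenter

/-! ### Null sets of arrows -/

/-- The arrows with range outside `A` are null for `μ ∘ lam`. Inversion exchanges range and source,
and quasi-invariance carries the null set across. -/
theorem BorelGroupoid.QuasiInvariant.ae_source_mem {U G : Type*} [MeasurableSpace U]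
    [MeasurableSpace G] {Γ : BorelGroupoid U G} {lam : Γ.HaarSystem} {μ : Measure U}
    (h : Γ.QuasiInvariant lam μ) {A : Set U} (hA : MeasurableSet A) (hμ : μ Aᶜ = 0) :
    ∀ᵐ x ∂μ, ∀ᵐ g ∂(lam.toKernel x), Γ.s g ∈ A := by
  have h1 : lam.integrate μ (Γ.r ⁻¹' Aᶜ) = 0 := by
    have hr : MeasurableSet (Γ.r ⁻¹' Aᶜ) := Γ.measurable_r hA.compl
    refine (Measure.bind_apply hr lam.toKernel.measurable.aemeasurable).trans ?_
    rw [lintegral_eq_zero_iff (lam.toKernel.measurable_coe hr)]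
    filter_upwards [show ∀ᵐ x ∂μ, x ∈ A from hμ] with x hx
    change ((lam.meas x).map Subtype.val) _ = 0
    rw [Measure.map_apply measurable_subtype_coe hr]
    convert measure_empty (μ := lam.meas x)
    ext g
    simpa [g.2] using hx
  have h2 : (lam.integrate μ).map Γ.inv (Γ.s ⁻¹' Aᶜ) = 0 := by
    rw [Measure.map_apply Γ.measurable_inv (Γ.measurable_s hA.compl), ← h1]
    congr 1
    ext g
    simp [Γ.s_inv]
  exact Measure.ae_ae_of_ae_comp (κ := lam.toKernel) (p := fun g => Γ.s g ∈ A) (h.1 h2)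

/-! ### Almost everywhere statements in the semi-direct groupoid -/

section SemiDirect

variable {U G X : Type*} [MeasurableSpace U] [MeasurableSpace G] [MeasurableSpace X] {Γ : BorelGroupoid U G}

theorem BorelSystem.ae_toKernel_iff {Z : Type*} [MeasurableSpace Z] [MeasurableSingletonClass X]
    {p : Z → X} (hp : Measurable p) (ρ : BorelSystem p) {x : X} {P : Z → Prop} :
    (∀ᵐ z ∂(ρ.toKernel x), P z) ↔ ∀ᵐ z ∂(ρ.meas x), P z.1 :=
  (MeasurableEmbedding.subtype_coe (hp (measurableSet_singleton x))).ae_map_iff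

theorem GSpace.measurableEmbedding_incl (E : GSpace Γ X) (x : X) :
    MeasurableEmbedding (E.incl x) := by
  refine MeasurableEmbedding.of_measurable_inverse (E.measurable_incl x) ?_
    (g := fun a => ⟨a.1.1.2, a.1.2.symm.trans (congrArg E.anchor a.2)⟩) ?_ fun _ => rfl
  · convert MeasurableSet.univ
    refine Set.eq_univ_of_forall ?_
    rintro ⟨⟨⟨x', g⟩, e⟩, h⟩
    change x' = x at h
    subst h
    exact ⟨⟨g, e.symm⟩, rfl⟩
  · exact (measurable_snd.comp (measurable_subtype_coe.comp measurable_subtype_coe)).subtype_mk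

theorem GSpace.act_src (E : GSpace Γ X) (a : E.SD) :
    E.act a.1.2 (E.src a) (E.anchor_src a).symm = a.1.1 := by
  have e : Γ.s (Γ.inv a.1.2) = E.anchor a.1.1 := (Γ.s_inv _).trans a.2.symm
  refine (E.mul_act a.1.2 (Γ.inv a.1.2) a.1.1 (Γ.r_inv _).symm e).symm.trans ?_
  rw [E.act_congr ((Γ.mul_inv _).trans (congrArg Γ.one a.2.symm)) rfl _ (Γ.s_one _), E.one_act]

theorem GSpace.src_act (E : GSpace Γ X) (g : G) (x : X) (e : Γ.s g = E.anchor x) :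
    E.src ⟨(E.act g x e, g), E.anchor_act g x e⟩ = x := by
  refine (E.mul_act (Γ.inv g) g x (Γ.s_inv g) e).symm.trans ?_
  rw [E.act_congr ((Γ.inv_mul g).trans (congrArg Γ.one e)) rfl _ (Γ.s_one _), E.one_act]

/-- Moves the quantifier from the fibre over `x` to the Haar measure on `G`, which depends on `x`
only through its anchor. Points of `Y` over the same `x` thus share one measure, as Fubini requires.
-/
theorem GSpace.ae_semidirectHaar_iff [StandardBorelSpace U] (E : GSpace Γ X)
    (lam : Γ.HaarSystem) (x : X)
    (S : Set E.SD) : (∀ᵐ g ∂((E.semidirectHaar lam).meas x), g.1 ∈ S) ↔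
      ∀ᵐ γ ∂(lam.toKernel (E.anchor x)), ∀ e : E.anchor x = Γ.r γ, ⟨(x, γ), e⟩ ∈ S := by
  refine ((E.measurableEmbedding_incl x).ae_map_iff (p := fun g => g.1 ∈ S)).trans ?_
  rw [lam.ae_toKernel_iff Γ.measurable_r]
  exact Filter.eventually_congr (Filter.Eventually.of_forall fun g =>
    ⟨fun h _ => h, fun h => h g.2.symm⟩)

end SemiDirect

/-! ### Descent of coboundaries along measure preserving maps -/

namespace EquivariantMap

variable {𝕜 : Type*} [RCLike 𝕜] {U G X Y : Type*} [MeasurableSpace U] [MeasurableSpace G]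
  [MeasurableSpace X] [MeasurableSpace Y] {Γ : BorelGroupoid U G} {F : GSpace Γ Y} {E : GSpace Γ X}

theorem measurable_fibTranslate (π : EquivariantMap F E) (g : G) (x : X)
    (e : Γ.s g = E.anchor x) : Measurable (π.fibTranslate g x e) := by
  refine Measurable.subtype_mk ?_
  have : Measurable fun z : Fib π.p x =>
      (⟨(g, z.1), e.trans ((congrArg E.anchor z.2.symm).trans (π.anchor_p _))⟩ :
        {q : G × Y // Γ.s q.1 = F.anchor q.2}) :=
    (measurable_const.prodMk measurable_subtype_coe).subtype_mk
  exact F.measurable_act.comp this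

/-- The translation from the fibre of `p` at the source of an arrow to the fibre at its range. -/
def fibArrow (π : EquivariantMap F E) (a : E.SD) (z : Fib π.p (E.src a)) : Fib π.p a.1.1 :=
  ⟨(π.fibTranslate a.1.2 (E.src a) (E.anchor_src a).symm z).1,
    (π.fibTranslate a.1.2 (E.src a) (E.anchor_src a).symm z).2.trans (E.act_src a)⟩

/-- This is the invariance of `ρ`; the range is generalised to a variable `x` because the fibres
over `g (g⁻¹ x)` and over `x` are equal only propositionally. -/
theorem measurePreserving_fibArrow (π : EquivariantMap F E) (ρ : BorelSystem π.p)
    (hρ : ∀ (g : G) (x : X) (e : Γ.s g = E.anchor x),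
      (ρ.meas x).map (π.fibTranslate g x e) = ρ.meas (E.act g x e)) (a : E.SD) :
    MeasurePreserving (π.fibArrow a) (ρ.meas (E.src a)) (ρ.meas a.1.1) := by
  have key : ∀ (x : X) (h : E.act a.1.2 (E.src a) (E.anchor_src a).symm = x),
      MeasurePreserving (fun z => (⟨(π.fibTranslate a.1.2 (E.src a) (E.anchor_src a).symm z).1,
        (π.fibTranslate a.1.2 (E.src a) (E.anchor_src a).symm z).2.trans h⟩ : Fib π.p x))
        (ρ.meas (E.src a)) (ρ.meas x) := by
    rintro _ rfl
    exact ⟨π.measurable_fibTranslate _ _ _, hρ _ _ _⟩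
  exact key _ (E.act_src a)

/-- The coboundary identity at an arrow of `Y ⋊ Γ`, read in the fibres of `H`. -/
theorem restrictFib_eq_of_coboundary (π : EquivariantMap F E) {μ : Measure X}
    {H : HilbertBundle 𝕜 X} (L : GroupoidRep E.semidirect μ H) (b : ArrowSection E.semidirect H)
    (η : ∀ y, H.fibre (π.p y)) {y z z' : Y} {x x' : X} (hy : π.p y = x) (hz : π.p z = x')
    (hz' : z' = z) (g : E.semidirect.Arr (π.p y) (π.p z')) (a : E.semidirect.Arr x x')
    (hg : g.1 = a.1) (h : b (π.p y) g.fib = η y - L.op (π.p y) (π.p z') g (η z')) :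
    restrictFib η x ⟨y, hy⟩ = b x a.fib + L.op x x' a (restrictFib η x' ⟨z, hz⟩) := by
  subst hy hz hz'
  obtain rfl : g = a := Subtype.ext hg
  rw [h]
  exact (sub_add_cancel _ _).symm

variable [StandardBorelSpace U] [StandardBorelSpace X] [StandardBorelSpace Y]

/-- If `b ∘ φ` is the coboundary of `η`, then `b` is the coboundary of the fibrewise centres
of `η`. -/
theorem aeEq_coboundary_fibreCenter (π : EquivariantMap F E) {lam : Γ.HaarSystem} {ν : Measure Y}
    {μ : Measure X} (hpair : π.IsMeasuredPair lam ν μ) {H : HilbertBundle 𝕜 X}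
    (L : GroupoidRep E.semidirect μ H) (ρ : BorelSystem π.p)
    [∀ x, IsProbabilityMeasure (ρ.meas x)]
    (hρ : ∀ (g : G) (x : X) (e : Γ.s g = E.anchor x),
      (ρ.meas x).map (π.fibTranslate g x e) = ρ.meas (E.act g x e))
    (hν : ν = ρ.integrate μ) {b : ArrowSection E.semidirect H} (hb : b.IsBorel)
    {η : ∀ y, H.fibre (π.p y)}
    (hη : (H.pullback π.hom.unit π.hom.measurable_unit).IsBorelSection η)
    (h : ArrowSection.AEEq (F.semidirectHaar lam) ν (π.hom.pullSection H b)
      (coboundary (π.rep hpair L) η)) :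
    ArrowSection.AEEq (E.semidirectHaar lam) μ b (coboundary L (fibreCenter ρ η)) := by
  have := lam.isSFiniteKernel lam.proper
  have hη' : Measurable fun y => H.pt (π.p y) (η y) :=
    (H.measurable_pt_iff _ _).2 ⟨π.measurable_p,
      (((H.pullback π.hom.unit π.hom.measurable_unit).measurable_pt_iff _ _).1 hη).2⟩
  -- The arrows of `Y ⋊ Γ` at which the coboundary identity holds. They form a Borel set, which the
  -- exchange of quantifiers below needs.
  let B : Set F.SD := {a | π.hom.pullSection H b a.1.1 ⟨a, rfl⟩ =
    coboundary (π.rep hpair L) η a.1.1 ⟨a, rfl⟩}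
  have hB : MeasurableSet B := (π.hom.pullSection_isBorel hb).measurableSet_eq
    (coboundary_isBorel (π.rep hpair L) hη)
  -- `B` extended to the whole product, pairs that are not arrows belonging to it vacuously, so that
  -- Fubini applies on `Y × G`.
  let D : Set (Y × G) := {q | ∀ e : F.anchor q.1 = Γ.r q.2, ⟨q, e⟩ ∈ B}
  have hD : MeasurableSet D := by
    convert (F.measurableSet_SD.subtype_image hB.compl).compl using 1
    ext q
    constructor
    · rintro hq ⟨⟨q, e⟩, hn, rfl⟩
      exact hn (hq e)
    · intro hq e
      by_contra hn
      exact hq ⟨⟨q, e⟩, hn, rfl⟩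
  have h1 : ∀ᵐ y ∂ν, ∀ᵐ γ ∂(lam.toKernel (F.anchor y)), (y, γ) ∈ D := by
    filter_upwards [h] with y hy
    refine (F.ae_semidirectHaar_iff lam y B).1 ?_
    filter_upwards [hy] with g hg
    obtain ⟨a, rfl⟩ := g
    exact hg
  -- Disintegrate `ν` along `p`. Over a fixed `x` the Haar measure is the same for all `y` in the
  -- fibre, so the quantifiers over `y` and `γ` can be exchanged.
  have h2 : ∀ᵐ x ∂μ, ∀ᵐ γ ∂(lam.toKernel (E.anchor x)), ∀ᵐ y ∂(ρ.meas x), (y.1, γ) ∈ D := by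
    rw [hν] at h1
    filter_upwards [Measure.ae_ae_of_ae_comp (κ := ρ.toKernel) h1] with x hx
    have hx' : ∀ᵐ y ∂(ρ.toKernel x), ∀ᵐ γ ∂(lam.toKernel (E.anchor x)), (y, γ) ∈ D := by
      rw [ρ.ae_toKernel_iff π.measurable_p] at hx ⊢
      filter_upwards [hx] with y hy
      rwa [← π.anchor_p, y.2] at hy
    filter_upwards [(Measure.ae_ae_comm (p := fun y γ => (y, γ) ∈ D) hD).1 hx'] with γ hγ
    exact (ρ.ae_toKernel_iff π.measurable_p).1 hγ
  obtain ⟨A, hA, hμ, hiso, -⟩ := L.strict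
  -- `L` is isometric only between units of `A`; the sources of almost all arrows must lie there as
  -- well as the ranges.
  have h3 : ∀ᵐ x ∂μ, ∀ᵐ g ∂((E.semidirectHaar lam).meas x), E.src g.1 ∈ A := by
    filter_upwards [hpair.quasiInvariant_right.ae_source_mem hA hμ] with x hx
    exact ((E.semidirectHaar lam).ae_toKernel_iff E.semidirect.measurable_r).1 hx
  filter_upwards [h2, h3, show ∀ᵐ x ∂μ, x ∈ A from hμ] with x hx hxs hxA
  have hxs' := (E.ae_semidirectHaar_iff lam x {a | E.src a ∈ A}).1 hxs
  have hgoal : ∀ᵐ g ∂((E.semidirectHaar lam).meas x), g.1 ∈ {a : E.SD | b a.1.1 ⟨a, rfl⟩ =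
      coboundary L (fibreCenter ρ η) a.1.1 ⟨a, rfl⟩} := by
    refine (E.ae_semidirectHaar_iff lam x _).2 ?_
    filter_upwards [hx, hxs'] with γ hγ hγs e
    set a : E.SD := ⟨(x, γ), e⟩ with ha
    let g : E.semidirect.Arr x (E.src a) := ⟨a, rfl, rfl⟩
    have hT := π.measurePreserving_fibArrow ρ hρ a
    have hae : ∀ᵐ z ∂(ρ.meas (E.src a)), restrictFib η x (π.fibArrow a z) =
        b x g.fib + L.op x (E.src a) g (restrictFib η (E.src a) z) := by
      -- The identity is known for almost every `y` over `x`; substituting `y = γ z` makes it hold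
      -- for almost every `z` over the source, by invariance of `ρ`.
      filter_upwards [hT.quasiMeasurePreserving.ae hγ] with z hz
      have e' : F.anchor (π.fibArrow a z).1 = Γ.r γ := F.anchor_act _ _ _
      exact π.restrictFib_eq_of_coboundary L b η (π.fibArrow a z).2 z.2 (F.src_act _ _ _)
        (π.hom.arr (Fib.arr (Γ := F.semidirect) ⟨⟨((π.fibArrow a z).1, γ), e'⟩, rfl⟩)) g
        (Subtype.ext (Prod.ext (π.fibArrow a z).2 rfl)) (hz e')
    -- The affine isometry is `v ↦ b γ + L γ v`.
    have hc := center_map hT (stronglyMeasurable_restrictFib hη' x)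
      (stronglyMeasurable_restrictFib hη' (E.src a)) (L.op x (E.src a) g)
      (hiso x hxA (E.src a) (hγs e) g).1 (b x g.fib) hae
    exact eq_sub_of_add_eq hc.symm
  filter_upwards [hgoal] with g hg
  obtain ⟨a, rfl⟩ := g
  exact hg

end EquivariantMap

/-! ### Classes of cocycles and of coboundaries -/

section Quotient

variable {𝕜 : Type*} [RCLike 𝕜] {U G : Type*} [MeasurableSpace U] [StandardBorelSpace U]
  [MeasurableSpace G] {Γ : BorelGroupoid U G}

/-- Being a coboundary is itself an almost everywhere condition, so it does not depend on the
representative of the class. -/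
theorem mk_mem_B1_iff (lam : Γ.HaarSystem) (μ : Measure U) {H : HilbertBundle 𝕜 U}
    (L : GroupoidRep Γ μ H) (b : cocycles lam μ L) :
    (nullCocycles lam μ L).mkQ b ∈ B1 lam μ L ↔ b ∈ coboundaries lam μ L := by
  refine ⟨?_, Submodule.mem_map_of_mem⟩
  rintro ⟨c, ⟨ξ, hξ, hc⟩, hcb⟩
  refine ⟨ξ, hξ, ?_⟩
  have hnull : ArrowSection.AEEq lam μ (c - b).1 0 := (Submodule.Quotient.eq _).1 hcb
  filter_upwards [hc, hnull] with x hx hx'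
  filter_upwards [hx, hx'] with g hg hg'
  rw [← hg]
  exact (sub_eq_zero.1 hg').symm

end Quotient

end MeasGrpd

end

/-! ### Injectivity on the first cohomology groups -/

theorem lemma5 {𝕜 : Type*} [RCLike 𝕜] {U G X Y : Type*}
    [MeasurableSpace U] [StandardBorelSpace U] [MeasurableSpace G] [StandardBorelSpace G]
    [MeasurableSpace X] [StandardBorelSpace X] [MeasurableSpace Y] [StandardBorelSpace Y]
    (Γ : BorelGroupoid U G) (lam : Γ.HaarSystem) (F : GSpace Γ Y) (E : GSpace Γ X)
    (ν : Measure Y) (μ : Measure X) [SigmaFinite ν] [SigmaFinite μ]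
    (π : EquivariantMap F E) (hpair : π.IsMeasuredPair lam ν μ)
    (herg : π.IsErgodicPair ν μ) (hmp : π.IsMeasurePreservingPair ν μ)
    (H : HilbertBundle 𝕜 X) (L : GroupoidRep E.semidirect μ H) :
    Function.Injective
      (π.cohomologyMap hpair L :
        H1 (E.semidirectHaar lam) μ L → H1 (F.semidirectHaar lam) ν (π.rep hpair L)) := by
  refine (injective_iff_map_eq_zero _).2 fun z hz => ?_
  -- `H¹` is a quotient of a quotient, so a representing cocycle is reached in two lifts.
  obtain ⟨z, rfl⟩ := Submodule.mkQ_surjective _ z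
  obtain ⟨b, rfl⟩ := Submodule.mkQ_surjective _ z
  obtain ⟨ρ, hprob, hρ, hν⟩ := hmp
  have h1 : (nullCocycles (F.semidirectHaar lam) ν (π.rep hpair L)).mkQ
      (π.hom.pullCocycle hpair.quasiMeasurePreserving (π.hom_preservesHaar lam) L b) ∈
      B1 (F.semidirectHaar lam) ν (π.rep hpair L) := (Submodule.Quotient.mk_eq_zero _).1 hz
  obtain ⟨η, hη, h⟩ := (mk_mem_B1_iff _ _ _ _).1 h1
  refine (Submodule.Quotient.mk_eq_zero _).2 ((mk_mem_B1_iff _ _ _ _).2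
    ⟨fibreCenter ρ η, ?_, π.aeEq_coboundary_fibreCenter hpair L ρ hρ hν b.2.1 hη h⟩)
  -- A section of the pull-back bundle and the corresponding map into the total space of `H` have
  -- the same coordinates, so one is Borel when the other is.
  exact fibreCenter_isBorelSection ρ π.measurable_p ((H.measurable_pt_iff _ _).2 ⟨π.measurable_p,
    (((H.pullback π.hom.unit π.hom.measurable_unit).measurable_pt_iff _ _).1 hη).2⟩)
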